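/- Let $\Omega$ be a finite state space with $n$ elements and let $\Delta(\Omega)\subset\mathbb R^{\Omega}$ be the simplex of beliefs, with degenerate beliefs $\delta_\omega$. Let $A$ be a compact metric space, and let $u_S:A\to\mathbb R$ and $u_R(\omega,\cdot):A\to\mathbb R$ ($\omega\in\Omega$) be continuous utilities of a sender and a receiver. Write $\mathbf V(\mu)=\mathrm{co}\,u_S\big(\arg\max_{a\in A}\mathbb E_\mu[u_R(\omega,a)]\big)$ for $\mu\in\Delta(\Omega)$. Assume that $\mathbf V(\mu)=\{V(\mu)\}$ is a singleton for every $\mu\in\Delta(\Omega)$, with $V(\mu)=v(T(\mu))$, where $T:\Delta(\Omega)\to\mathbb R^k$ is the restriction of a linear map, $X:=T(\Delta(\Omega))$ is $k$-dimensional (full rank), $k\ge 2$, and $v$ is a real function whose restriction to $X$ is continuous and strictly quasiconvex ($v(tx+(1-t)y)<\max\{v(x),v(y)\}$ for $x\ne y$ in $X$, $t\in(0,1)$). Let $T(\Omega)=\{T(\delta_\omega):\omega\in\Omega\}$ and assume that $v$ is minimally edge non-monotone given $T$: there is a minimizer $\underline x$ of $v$ on $T(\Omega)$ such that, for every $x\in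 T(\Omega)\setminus\{\underline x\}$, the function $\lambda\mapsto v(\lambda x+(1-\lambda)\underline x)$ is neither weakly increasing nor weakly decreasing on $[0,1]$. For a prior $p\in\Delta(\Omega)$, let $\mathcal T_{BP}(p)$ be the set of Borel probability measures $\tau$ on $\Delta(\Omega)$ with $\int\mu\,d\tau(\mu)=p$. Let $\mathcal V_{BP}(p)$, $\mathcal V_{MD}(p)$ and $\mathcal V_{CT}(p)$ be the suprema of $\int V\,d\tau$ over, respectively, all $\tau\in\mathcal T_{BP}(p)$ (persuasion), those with $\mathrm{Cov}_\tau[V(\mu),\mu(\omega)]=0$ for all $\omega$ (mediation), and those for which $V$ is constant on $\mathrm{supp}(\tau)$ (cheap talk). Full dimensionality holds at $p$ if $$\bigcup_{\tau}\big(\mathrm{aff}(\mathrm{supp}\,\tau)\cap\Delta(\Omega)\big)=\Delta(\Omega),$$ where the union is over all finitely supported $\tau\in\mathcal T_{BP}(p)$ with $V=\mathcal V_{CT}(p)$ on $\mathrm{supp}(\tau)$. Then there are a state $\underline\omega\in\arg\min_{\omega}V(\delta_\omega)$ and, for each $\omega\ne\underline\omega$, a belief $\mu_\omega$ in the segment $(\delta_{\underline\omega},\delta_\omega]$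 with $V(\mu_\omega)=V(\delta_{\underline\omega})$, which is the only such belief in that segment whenever $T(\delta_\omega)\neq T(\delta_{\underline\omega})$, such that $\tilde\Delta=\mathrm{co}\big(\{\delta_{\underline\omega}\}\cup\{\mu_\omega:\omega\ne\underline\omega\}\big)$ is an $(n-1)$-simplex in $\Delta(\Omega)$ and, for every full-support prior $p\in\tilde\Delta$: (a) full dimensionality holds at $p$; (b) the strict chain $\max_{\Delta(\Omega)}V>\mathcal V_{BP}(p)>\mathcal V_{MD}(p)>\mathcal V_{CT}(p)>V(p)$ holds if and only if $\min_{x\in T(\Omega)}v(x)<\max_{x\in X}v(x)$. -/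

import Mathlib

open Set MeasureTheory

noncomputable section

namespace CheapTalk

/-! ### Beliefs and the indirect value correspondence -/

/-- Beliefs over a finite state space `Ω`: the simplex `Δ(Ω) ⊆ ℝ^Ω`. -/
abbrev Belief (Ω : Type*) [Fintype Ω] : Type _ := stdSimplex ℝ Ω

/-- The degenerate belief `δ_ω`. -/
abbrev dirac {Ω : Type*} [Fintype Ω] [DecidableEq Ω] (ω : Ω) : Belief Ω :=
  ⟨Pi.single ω 1, single_mem_stdSimplex ℝ ω⟩

/-- The receiver's best responses at the belief `μ`: the maximizers over `A` of `E_μ[u_R(ω, a)]`. -/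
def bestResponses {Ω A : Type*} [Fintype Ω] (uR : Ω → A → ℝ) (μ : Belief Ω) : Set A :=
  {a | ∀ a' : A, ∑ ω, μ.1 ω * uR ω a' ≤ ∑ ω, μ.1 ω * uR ω a}

/-- The indirect value correspondence `𝐕(μ) = co (u_S (argmax_a E_μ[u_R(ω, a)]))`. -/
def indirectValue {Ω A : Type*} [Fintype Ω] (uS : A → ℝ) (uR : Ω → A → ℝ) (μ : Belief Ω) : Set ℝ :=
  convexHull ℝ (uS '' bestResponses uR μ)

/-! ### Implementable distributions over posteriors and optimal values

Below, `VV` is a correspondence from beliefs to sender payoffs and `p` is the prior. -/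

section Values

variable {Ω : Type*} [Fintype Ω]

/-- `V` is a measurable selection of the correspondence `VV`. -/
def IsSelection (VV : Belief Ω → Set ℝ) (V : Belief Ω → ℝ) : Prop :=
  Measurable V ∧ ∀ μ, V μ ∈ VV μ

/-- `𝒯_BP(p)`: Borel probability measures on `Δ(Ω)` whose barycenter is `p`. -/
def bayesPlausible (p : Belief Ω) : Set (Measure (Belief Ω)) :=
  {τ | IsProbabilityMeasure τ ∧ ∀ ω, ∫ μ, μ.1 ω ∂τ = p.1 ω}

/-- `(τ, V)` is feasible under mediation at `p`: `τ` is Bayes plausible, `V` is a measurable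
selection, and the sender's payoff is uncorrelated with the receiver's belief. -/
def MediationFeasible (VV : Belief Ω → Set ℝ) (p : Belief Ω)
    (τ : Measure (Belief Ω)) (V : Belief Ω → ℝ) : Prop :=
  τ ∈ bayesPlausible p ∧ IsSelection VV V ∧
    ∀ ω, ProbabilityTheory.covariance V (fun μ => μ.1 ω) τ = 0

/-- `(τ, V)` is feasible under cheap talk at `p`: `τ` is Bayes plausible, and `V` is a measurable
selection that is constant on the support of `τ`. -/
def CheapTalkFeasible (VV : Belief Ω → Set ℝ) (p : Belief Ω)
    (τ : Measure (Belief Ω)) (V : Belief Ω → ℝ) : Prop :=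
  τ ∈ bayesPlausible p ∧ IsSelection VV V ∧ ∀ μ ∈ τ.support, ∀ ν ∈ τ.support, V μ = V ν

/-- `𝒯_CT(p)`: the distributions over posteriors that are implementable under cheap talk. -/
def cheapTalkDistributions (VV : Belief Ω → Set ℝ) (p : Belief Ω) : Set (Measure (Belief Ω)) :=
  {τ | ∃ V, CheapTalkFeasible VV p τ V}

/-- `𝒱_BP(p)`: the optimal value under Bayesian persuasion, the supremum over Bayes plausible `τ`
of the `τ`-expectation of the upper envelope `max 𝐕(μ)`. -/
def valueBP (VV : Belief Ω → Set ℝ) (p : Belief Ω) : ℝ :=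
  sSup {s | ∃ τ ∈ bayesPlausible p, s = ∫ μ, sSup (VV μ) ∂τ}

/-- `𝒱_MD(p)`: the optimal value under mediation. -/
def valueMD (VV : Belief Ω → Set ℝ) (p : Belief Ω) : ℝ :=
  sSup {s | ∃ τ V, MediationFeasible VV p τ V ∧ s = ∫ μ, V μ ∂τ}

/-- `𝒱_CT(p)`: the value of the sender's preferred cheap talk equilibrium. -/
def valueCT (VV : Belief Ω → Set ℝ) (p : Belief Ω) : ℝ :=
  sSup {s | ∃ τ V, CheapTalkFeasible VV p τ V ∧ s = ∫ μ, V μ ∂τ}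

/-! ### The cheap talk hull and full dimensionality -/

/-- The cheap talk hull `H(s)` at `p`: the union of the sets `aff(supp τ) ∩ Δ(Ω)` over the finitely
supported `τ ∈ 𝒯_CT(p)` that attain `s`, that is, with `s ∈ 𝐕(μ)` for every `μ ∈ supp τ`. -/
def cheapTalkHull (VV : Belief Ω → Set ℝ) (p : Belief Ω) (s : ℝ) : Set (Ω → ℝ) :=
  ⋃ τ ∈ {τ | τ ∈ cheapTalkDistributions VV p ∧ τ.support.Finite ∧ ∀ μ ∈ τ.support, s ∈ VV μ},
    (affineSpan ℝ ((fun μ : Belief Ω => μ.1) '' τ.support) : Set (Ω → ℝ)) ∩ stdSimplex ℝ Ω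

/-- The full-dimensionality condition at `p`: `H(𝒱_CT(p)) = Δ(Ω)`. -/
def FullDimensionality (VV : Belief Ω → Set ℝ) (p : Belief Ω) : Prop :=
  cheapTalkHull VV p (valueCT VV p) = stdSimplex ℝ Ω

end Values

/-! ### Moments and assumptions on the utility function of the moment -/

/-- `v` is strictly quasiconvex on the set `X`. -/
def StrictQuasiconvexOn {E : Type*} [AddCommGroup E] [Module ℝ E] (X : Set E) (v : E → ℝ) : Prop :=
  Convex ℝ X ∧ ∀ x ∈ X, ∀ y ∈ X, x ≠ y → ∀ t ∈ Ioo (0 : ℝ) 1,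
    v (t • x + (1 - t) • y) < max (v x) (v y)

section Moments

variable {Ω : Type*} [Fintype Ω] {k : ℕ}

/-- The set `X = T(Δ(Ω))` of relevant moments. -/
def momentSet (T : (Ω → ℝ) →ₗ[ℝ] (Fin k → ℝ)) : Set (Fin k → ℝ) := T '' stdSimplex ℝ Ω

/-- `T` is a `k`-dimensional moment: a linear map which has full rank `k` on `Δ(Ω)`, that is,
`T(Δ(Ω))` is `k`-dimensional. In particular `k ≤ |Ω| - 1`. -/
def IsMoment (T : (Ω → ℝ) →ₗ[ℝ] (Fin k → ℝ)) : Prop := affineSpan ℝ (momentSet T) = ⊤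

variable [DecidableEq Ω]

/-- The finite set `T(Ω)` of the points `T(δ_ω)`. -/
def momentVertices (T : (Ω → ℝ) →ₗ[ℝ] (Fin k → ℝ)) : Set (Fin k → ℝ) :=
  range fun ω : Ω => T (dirac ω).1

/-- `v` is minimally edge non-monotone given `T`. -/
def MinimallyEdgeNonMonotone (T : (Ω → ℝ) →ₗ[ℝ] (Fin k → ℝ)) (v : (Fin k → ℝ) → ℝ) : Prop :=
  ∃ x₀ ∈ momentVertices T, (∀ x ∈ momentVertices T, v x₀ ≤ v x) ∧
    ∀ x ∈ momentVertices T, x ≠ x₀ →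
      ¬ MonotoneOn (fun t : ℝ => v (t • x + (1 - t) • x₀)) (Icc 0 1) ∧
      ¬ AntitoneOn (fun t : ℝ => v (t • x + (1 - t) • x₀)) (Icc 0 1)

end Moments

end CheapTalk

end

/-! Write `s` for the lowest vertex value, attained at `δ_{ω₀}`. On the edge towards `δ_ω` the value
starts at `s`, dips and returns to `s` once (`exists_unique_return`); if the moment does not vary on
the edge, the far vertex itself serves. The return points and `δ_{ω₀}` span the part of the belief
simplex inside one half-space. Sublevel sets are convex, so the value is at most `s` on it, and any
belief worth more lies strictly outside.

Cheap talk: a distribution supported on a level above `s` would have its mean outside the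
half-space, so the value is at most `s`. The prior is worth less than `s`, since it is the midpoint
of two beliefs in the spanned simplex with different moments; this uses `k ≥ 2`. Hence each ray from
the prior to a vertex meets the level `s`, and mixing these crossings attains `s`. Their affine hull
contains the prior, hence every vertex: this is full dimensionality
(`fullDimensionality_of_moment`).

Mediation beats `s` when some belief does: beliefs worth `s` contribute nothing to covariances net
of `s`, so they repair Bayes plausibility for free (`lt_valueMD_of_weights`), and a family with the
right weighted barycenter is found in a plane on which the moment is injective
(`exists_pos_pair_neg_beyond`). Persuasion beats mediation: means above `s` force a uniformly
positive variance, and zero covariance lets a tilt towards high payoffs keep the prior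
(`valueMD_lt_valueBP`). The global maximum is out of reach because every belief giving weight to
`ω₀` falls short of it (`valueBP_lt`, `moment_lt_of_pos`). -/

noncomputable section

namespace CheapTalk

/-! ### Integration on the belief simplex -/

section Measures

variable {Ω : Type*} [Fintype Ω]

theorem integrable_of_continuous {f : Belief Ω → ℝ} (hf : Continuous f)
    (τ : Measure (Belief Ω)) [IsFiniteMeasure τ] : Integrable f τ :=
  hf.integrable_of_hasCompactSupport (HasCompactSupport.of_compactSpace f)

theorem continuous_apply_belief (ω : Ω) : Continuous fun μ : Belief Ω => μ.1 ω :=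
  (continuous_apply ω).comp continuous_subtype_val

theorem covariance_eq {f g : Belief Ω → ℝ} (hf : Continuous f) (hg : Continuous g)
    (τ : Measure (Belief Ω)) [IsProbabilityMeasure τ] :
    ProbabilityTheory.covariance f g τ = ∫ μ, f μ * g μ ∂τ - (∫ μ, f μ ∂τ) * ∫ μ, g μ ∂τ := by
  have h : ∀ {f : Belief Ω → ℝ}, Continuous f → MemLp f 2 τ := fun {f} hf => by
    rw [memLp_two_iff_integrable_sq hf.aestronglyMeasurable]
    exact integrable_of_continuous (hf.pow 2) τ
  rw [ProbabilityTheory.covariance_eq_sub (h hf) (h hg)]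
  rfl

/-- The finitely supported measure with mass `a i` at `q i`. -/
def finiteMix {ι : Type*} [Fintype ι] (a : ι → ℝ) (q : ι → Belief Ω) : Measure (Belief Ω) :=
  ∑ i, ENNReal.ofReal (a i) • Measure.dirac (q i)

/-! ### Finitely supported distributions over posteriors -/

section FiniteMix

variable {ι : Type*} [Fintype ι] {a : ι → ℝ} {q : ι → Belief Ω}

theorem integral_finiteMix (ha : ∀ i, 0 ≤ a i) {f : Belief Ω → ℝ} (hf : Continuous f) :
    ∫ μ, f μ ∂(finiteMix a q) = ∑ i, a i * f (q i) := by
  unfold finiteMix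
  rw [integral_finsetSum_measure]
  · refine Finset.sum_congr rfl fun i _ => ?_
    rw [integral_smul_measure, integral_dirac, ENNReal.toReal_ofReal (ha i), smul_eq_mul]
  · intro i _
    exact (integrable_of_continuous hf _).smul_measure ENNReal.ofReal_ne_top

theorem isProbabilityMeasure_finiteMix (ha : ∀ i, 0 ≤ a i) (hs : ∑ i, a i = 1) :
    IsProbabilityMeasure (finiteMix a q) := by
  constructor
  simp only [finiteMix, Measure.coe_finsetSum, Measure.coe_smul, Finset.sum_apply, Pi.smul_apply,
    measure_univ, smul_eq_mul, mul_one]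
  rw [← ENNReal.ofReal_sum_of_nonneg fun i _ => ha i, hs, ENNReal.ofReal_one]

theorem finiteMix_mem_bayesPlausible (ha : ∀ i, 0 ≤ a i) (hs : ∑ i, a i = 1) {p : Belief Ω}
    (hp : ∀ ω, ∑ i, a i * (q i).1 ω = p.1 ω) : finiteMix a q ∈ bayesPlausible p :=
  ⟨isProbabilityMeasure_finiteMix ha hs, fun ω => by
    rw [integral_finiteMix ha (continuous_apply_belief ω), hp]⟩

/-- A finite set is closed and carries all the mass, and every neighbourhood of an atom has at least
its mass. Zero masses must be excluded, since their points could drop out of the support. -/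
theorem support_finiteMix (ha : ∀ i, 0 < a i) : (finiteMix a q).support = range q := by
  apply Subset.antisymm
  · apply Measure.support_subset_of_isClosed (finite_range q).isClosed
    rw [mem_ae_iff]
    simp [finiteMix]
  · rintro _ ⟨i, rfl⟩
    rw [Measure.mem_support_iff_forall]
    intro U hU
    have h1 : ENNReal.ofReal (a i) ≤ finiteMix a q U := by
      simp only [finiteMix, Measure.coe_finsetSum, Measure.coe_smul, Finset.sum_apply,
        Pi.smul_apply, smul_eq_mul]
      refine le_trans ?_ (Finset.single_le_sum (fun _ _ => zero_le) (Finset.mem_univ i))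
      rw [Measure.dirac_apply_of_mem (mem_of_mem_nhds hU), mul_one]
    exact lt_of_lt_of_le (ENNReal.ofReal_pos.2 (ha i)) h1

end FiniteMix

/-! ### Values when the correspondence is single-valued and continuous -/

section SingleValued

variable {VV : Belief Ω → Set ℝ} {V : Belief Ω → ℝ} {p : Belief Ω} {τ : Measure (Belief Ω)}

/-- This removes the choice of selection from the definitions of the three values. -/
theorem IsSelection.eq {V' : Belief Ω → ℝ} (h : IsSelection VV V') (hVV : ∀ μ, VV μ = {V μ}) :
    V' = V := by
  funext μ
  have := h.2 μ
  rwa [hVV, mem_singleton_iff] at this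

theorem isSelection_of_singleton (hVV : ∀ μ, VV μ = {V μ}) (hV : Continuous V) :
    IsSelection VV V :=
  ⟨hV.measurable, fun μ => by rw [hVV]; rfl⟩

theorem integral_le_of_forall_le (hV : Continuous V) {M : ℝ} (hM : ∀ μ, V μ ≤ M)
    (hτ : τ ∈ bayesPlausible p) : ∫ μ, V μ ∂τ ≤ M := by
  have := hτ.1
  have := integral_mono (integrable_of_continuous hV τ) (integrable_const M) hM
  simpa using this

theorem exists_forall_le (hV : Continuous V) (p : Belief Ω) : ∃ μ₀, ∀ μ, V μ ≤ V μ₀ := by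
  have : Nonempty (Belief Ω) := ⟨p⟩
  obtain ⟨μ₀, -, h⟩ := isCompact_univ.exists_isMaxOn univ_nonempty hV.continuousOn
  exact ⟨μ₀, fun μ => h (mem_univ μ)⟩

theorem integral_le_valueBP (hVV : ∀ μ, VV μ = {V μ}) (hV : Continuous V)
    (hτ : τ ∈ bayesPlausible p) : ∫ μ, V μ ∂τ ≤ valueBP VV p := by
  obtain ⟨μ₀, hM⟩ := exists_forall_le hV p
  -- The real `sSup` is an upper bound only for bounded sets; the maximum of `V` over the compact
  -- simplex provides the bound.
  refine le_csSup ⟨V μ₀, ?_⟩ ⟨τ, hτ, by simp only [hVV, csSup_singleton]⟩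
  rintro _ ⟨τ', hτ', rfl⟩
  simp only [hVV, csSup_singleton]
  exact integral_le_of_forall_le hV hM hτ'

theorem dirac_mem_bayesPlausible (p : Belief Ω) : Measure.dirac p ∈ bayesPlausible p :=
  ⟨inferInstance, fun _ => integral_dirac _ _⟩

theorem valueBP_le (hVV : ∀ μ, VV μ = {V μ}) {c : ℝ}
    (h : ∀ τ ∈ bayesPlausible p, ∫ μ, V μ ∂τ ≤ c) : valueBP VV p ≤ c := by
  refine csSup_le ⟨_, Measure.dirac p, dirac_mem_bayesPlausible p, rfl⟩ ?_
  rintro _ ⟨τ, hτ, rfl⟩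
  simp only [hVV, csSup_singleton]
  exact h τ hτ

theorem integral_le_valueMD (hVV : ∀ μ, VV μ = {V μ}) (hV : Continuous V)
    (hτ : τ ∈ bayesPlausible p)
    (hc : ∀ ω, ProbabilityTheory.covariance V (fun μ => μ.1 ω) τ = 0) :
    ∫ μ, V μ ∂τ ≤ valueMD VV p := by
  obtain ⟨μ₀, hM⟩ := exists_forall_le hV p
  refine le_csSup ⟨V μ₀, ?_⟩ ⟨τ, V, ⟨hτ, isSelection_of_singleton hVV hV, hc⟩, rfl⟩
  rintro _ ⟨τ', V', ⟨hτ', hs, -⟩, rfl⟩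
  rw [hs.eq hVV]
  exact integral_le_of_forall_le hV hM hτ'

/-- Near-optimal mediation plans are enough for what follows, so attainment of the supremum is never
needed. The uninformative plan shows that the set of values is nonempty. -/
theorem exists_lt_integral_of_lt_valueMD (hVV : ∀ μ, VV μ = {V μ}) (hV : Continuous V) {c : ℝ}
    (h : c < valueMD VV p) :
    ∃ τ ∈ bayesPlausible p, (∀ ω, ProbabilityTheory.covariance V (fun μ => μ.1 ω) τ = 0) ∧
      c < ∫ μ, V μ ∂τ := by
  have hd : MediationFeasible VV p (Measure.dirac p) V :=
    ⟨dirac_mem_bayesPlausible p, isSelection_of_singleton hVV hV, fun ω => by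
      rw [covariance_eq hV (continuous_apply_belief ω)]
      simp only [integral_dirac, sub_self]⟩
  unfold valueMD at h
  obtain ⟨_, ⟨τ, V', ⟨hτ, hs, hc⟩, rfl⟩, hlt⟩ :=
    exists_lt_of_lt_csSup (by exact ⟨_, _, _, hd, rfl⟩) h
  rw [hs.eq hVV] at hc hlt
  exact ⟨τ, hτ, hc, hlt⟩

/-- On a support where `V` is constant, the integral is that constant. -/
theorem integral_eq_of_forall_mem_support [IsProbabilityMeasure τ] {c : ℝ}
    (h : ∀ μ ∈ τ.support, V μ = c) : ∫ μ, V μ ∂τ = c := by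
  have : V =ᵐ[τ] fun _ => c := by
    filter_upwards [Measure.support_mem_ae (μ := τ)] with μ hμ using h μ hμ
  rw [integral_congr_ae this]
  simp

theorem integral_le_valueCT (hVV : ∀ μ, VV μ = {V μ}) (hV : Continuous V)
    (hτ : τ ∈ bayesPlausible p) (hc : ∀ μ ∈ τ.support, ∀ ν ∈ τ.support, V μ = V ν) :
    ∫ μ, V μ ∂τ ≤ valueCT VV p := by
  obtain ⟨μ₀, hM⟩ := exists_forall_le hV p
  refine le_csSup ⟨V μ₀, ?_⟩ ⟨τ, V, ⟨hτ, isSelection_of_singleton hVV hV, hc⟩, rfl⟩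
  rintro _ ⟨τ', V', ⟨hτ', hs, -⟩, rfl⟩
  rw [hs.eq hVV]
  exact integral_le_of_forall_le hV hM hτ'

/-- The value of cheap talk is at most `c` if no Bayes plausible distribution is supported on a
level set of `V` above `c`. -/
theorem valueCT_le (hVV : ∀ μ, VV μ = {V μ}) (hV : Continuous V) {c : ℝ}
    (h : ∀ τ ∈ bayesPlausible p, ∀ s, (∀ μ ∈ τ.support, V μ = s) → s ≤ c) :
    valueCT VV p ≤ c := by
  refine csSup_le ⟨_, Measure.dirac p, V, ⟨dirac_mem_bayesPlausible p,
    isSelection_of_singleton hVV hV, ?_⟩, rfl⟩ ?_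
  · have : (Measure.dirac p).support ⊆ {p} := by
      apply Measure.support_subset_of_isClosed isClosed_singleton
      rw [mem_ae_iff]
      simp
    intro μ hμ ν hν
    rw [this hμ, this hν]
  · rintro _ ⟨τ, V', ⟨hτ, hs, hc⟩, rfl⟩
    rw [hs.eq hVV] at hc ⊢
    have := hτ.1
    obtain ⟨μ, hμ⟩ := Measure.nonempty_support (IsProbabilityMeasure.ne_zero τ)
    have hμ' : ∀ ν ∈ τ.support, V ν = V μ := fun ν hν => hc ν hν μ hμ
    rw [integral_eq_of_forall_mem_support hμ']
    exact h τ hτ _ hμ'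

/-- Reweighting a mediation-feasible distribution in the direction of higher payoffs keeps it
Bayes plausible and raises the payoff by a multiple of its variance. -/
theorem integral_add_variance_le_valueBP (hVV : ∀ μ, VV μ = {V μ}) (hV : Continuous V)
    (hτ : τ ∈ bayesPlausible p)
    (hc : ∀ ω, ProbabilityTheory.covariance V (fun μ => μ.1 ω) τ = 0) {κ : ℝ}
    (hκ : ∀ μ, 0 ≤ 1 + κ * (V μ - ∫ ν, V ν ∂τ)) :
    ∫ μ, V μ ∂τ + κ * ∫ μ, (V μ - ∫ ν, V ν ∂τ) ^ 2 ∂τ ≤ valueBP VV p := by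
  have := hτ.1
  set m := ∫ ν, V ν ∂τ with hm
  set g : Belief Ω → ℝ := fun μ => 1 + κ * (V μ - m) with hg
  have hgc : Continuous g := by fun_prop
  -- Tilting by `g` moves the mean of `f` by `κ` times its covariance with `V`: zero for the
  -- coordinates of the belief, the variance for `V` itself.
  have hint : ∀ f : Belief Ω → ℝ, Continuous f →
      ∫ μ, f μ ∂(τ.withDensity fun μ => ENNReal.ofReal (g μ)) =
        ∫ μ, f μ ∂τ + κ * (∫ μ, V μ * f μ ∂τ - m * ∫ μ, f μ ∂τ) := by
    intro f hf
    rw [integral_withDensity_eq_integral_toReal_smul (by fun_prop)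
      (Filter.Eventually.of_forall fun _ => ENNReal.ofReal_lt_top)]
    have : ∀ μ, (ENNReal.ofReal (g μ)).toReal • f μ = f μ + κ * (V μ * f μ - m * f μ) := by
      intro μ
      rw [ENNReal.toReal_ofReal (hκ μ), smul_eq_mul]
      ring
    simp only [this]
    rw [integral_add (integrable_of_continuous hf τ)
      (integrable_of_continuous (by fun_prop) τ), integral_const_mul,
      integral_sub (integrable_of_continuous (by fun_prop) τ)
      (integrable_of_continuous (by fun_prop) τ), integral_const_mul]
  have hprob : IsProbabilityMeasure (τ.withDensity fun μ => ENNReal.ofReal (g μ)) := by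
    constructor
    rw [withDensity_apply _ MeasurableSet.univ, Measure.restrict_univ,
      ← ofReal_integral_eq_lintegral_ofReal (integrable_of_continuous hgc τ)
        (Filter.Eventually.of_forall hκ), hg,
      integral_add (integrable_const _) (integrable_of_continuous (by fun_prop) τ),
      integral_const_mul, integral_sub (integrable_of_continuous hV τ) (integrable_const _), ← hm]
    simp
  have hmem : (τ.withDensity fun μ => ENNReal.ofReal (g μ)) ∈ bayesPlausible p := by
    refine ⟨hprob, fun ω => ?_⟩
    have h0 := hc ω
    rw [covariance_eq hV (continuous_apply_belief ω)] at h0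
    rw [hint _ (continuous_apply_belief ω), h0, mul_zero, add_zero, hτ.2 ω]
  refine le_trans (le_of_eq ?_) (integral_le_valueBP hVV hV hmem)
  rw [hint V hV]
  congr 2
  have : ∀ μ, (V μ - m) ^ 2 = V μ * V μ - (2 * m) * V μ + m ^ 2 := fun μ => by ring
  simp only [this]
  rw [integral_add (integrable_of_continuous (by fun_prop) τ) (integrable_const _),
    integral_sub (integrable_of_continuous (by fun_prop) τ)
      (integrable_of_continuous (by fun_prop) τ), integral_const_mul, ← hm]
  simp
  ring

end SingleValued

end Measures

/-! ### Comparing the values of cheap talk, mediation and persuasion -/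

section Bounds

variable {Ω : Type*} [Fintype Ω] {VV : Belief Ω → Set ℝ} {V : Belief Ω → ℝ} {p : Belief Ω}

/-- Compactness of `{a ≤ f}` turns a pointwise strict inequality into a uniform gap, which survives
integration and suprema. -/
theorem exists_pos_forall_add_le {f g : Belief Ω → ℝ} (hf : Continuous f) (hg : Continuous g)
    {a b : ℝ} (h : ∀ μ, a ≤ f μ → b < g μ) : ∃ η > 0, ∀ μ, a ≤ f μ → b + η ≤ g μ := by
  rcases (Set.eq_empty_or_nonempty {μ | a ≤ f μ}) with he | hne
  · exact ⟨1, one_pos, fun μ hμ => absurd (show μ ∈ {μ | a ≤ f μ} from hμ) (he ▸ notMem_empty μ)⟩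
  · have hK : IsCompact {μ | a ≤ f μ} := (isClosed_le continuous_const hf).isCompact
    obtain ⟨μ₀, h₀, hmin⟩ := hK.exists_isMinOn hne hg.continuousOn
    refine ⟨g μ₀ - b, sub_pos.2 (h μ₀ h₀), fun μ hμ => ?_⟩
    have : g μ₀ ≤ g μ := hmin hμ
    linarith

theorem continuous_sum_mul (c : Ω → ℝ) : Continuous fun μ : Belief Ω => ∑ ω, c ω * μ.1 ω :=
  continuous_finsetSum _ fun ω _ => continuous_const.mul (continuous_apply_belief ω)

theorem integral_sum_mul (c : Ω → ℝ) {τ : Measure (Belief Ω)} (hτ : τ ∈ bayesPlausible p) :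
    ∫ μ, ∑ ω, c ω * μ.1 ω ∂τ = ∑ ω, c ω * p.1 ω := by
  have := hτ.1
  rw [integral_finsetSum _ fun ω _ =>
    (integrable_of_continuous (continuous_apply_belief ω) τ).const_mul (c ω)]
  exact Finset.sum_congr rfl fun ω _ => by rw [integral_const_mul, hτ.2 ω]

/-- If a state `ω₀` has positive probability and is incompatible with attaining `M`, then
persuasion cannot attain `M`. -/
theorem valueBP_lt (hVV : ∀ μ, VV μ = {V μ}) (hV : Continuous V) {M : ℝ} (hM : ∀ μ, V μ ≤ M)
    {ω₀ : Ω} (hp : 0 < p.1 ω₀) (h : ∀ μ : Belief Ω, 0 < μ.1 ω₀ → V μ < M) :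
    valueBP VV p < M := by
  obtain ⟨η, hη, hη'⟩ := exists_pos_forall_add_le (continuous_apply_belief ω₀)
    (g := fun μ => -V μ) hV.neg (a := p.1 ω₀ / 2) (b := -M)
    fun μ hμ => neg_lt_neg (h μ (by linarith))
  refine lt_of_le_of_lt (valueBP_le hVV (c := M - η * (p.1 ω₀ / 2)) fun τ hτ => ?_) (by
    have := mul_pos hη (half_pos hp)
    linarith)
  have := hτ.1
  -- An affine majorant of `V`, whose integral depends only on the prior. The threshold `p.1 ω₀ / 2`
  -- leaves a loss of `η * (p.1 ω₀ / 2)` on average.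
  have hle : ∀ μ : Belief Ω, V μ ≤ M - η * (μ.1 ω₀ - p.1 ω₀ / 2) := by
    intro μ
    by_cases hμ : p.1 ω₀ / 2 ≤ μ.1 ω₀
    · have h1 := hη' μ hμ
      have h2 : μ.1 ω₀ ≤ 1 := by
        rw [← μ.2.2]
        exact Finset.single_le_sum (fun i _ => μ.2.1 i) (Finset.mem_univ ω₀)
      nlinarith
    · push Not at hμ
      have := hM μ
      nlinarith
  have hi := integrable_of_continuous (continuous_apply_belief ω₀) τ
  have hi' := (hi.sub (integrable_const (p.1 ω₀ / 2))).const_mul η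
  refine (integral_mono (integrable_of_continuous hV τ)
    ((integrable_const M).sub hi') hle).trans (le_of_eq ?_)
  simp only [Pi.sub_apply] at hi' ⊢
  rw [integral_sub (integrable_const _) hi', integral_const_mul,
    integral_sub hi (integrable_const _), hτ.2 ω₀]
  simp only [integral_const, probReal_univ, one_smul]
  ring

/-- A half-space containing the prior and no belief worth more than `s` bounds cheap talk. -/
theorem valueCT_le_of_halfSpace (hVV : ∀ μ, VV μ = {V μ}) (hV : Continuous V) {s : ℝ} (c : Ω → ℝ)
    (hp : ∑ ω, c ω * p.1 ω ≤ 1) (h : ∀ μ : Belief Ω, s < V μ → 1 < ∑ ω, c ω * μ.1 ω) :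
    valueCT VV p ≤ s := by
  refine valueCT_le hVV hV fun τ hτ s' hs' => ?_
  by_contra! hlt
  have := hτ.1
  obtain ⟨η, hη, hη'⟩ := exists_pos_forall_add_le hV (continuous_sum_mul c) (a := s') (b := 1)
    fun μ hμ => h μ (hlt.trans_le hμ)
  have hae : (fun _ => 1 + η) ≤ᵐ[τ] fun μ : Belief Ω => ∑ ω, c ω * μ.1 ω := by
    filter_upwards [Measure.support_mem_ae (μ := τ)] with μ hμ using hη' μ (hs' μ hμ).ge
  have := integral_mono_ae (integrable_const _)
    (integrable_of_continuous (continuous_sum_mul c) τ) hae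
  rw [integral_sum_mul c hτ] at this
  simp at this
  linarith

/-- Under the half-space condition, payoffs above `s` have variance bounded away from zero, so
persuasion strictly improves on mediation. -/
theorem valueMD_lt_valueBP (hVV : ∀ μ, VV μ = {V μ}) (hV : Continuous V) {s : ℝ} {c : Ω → ℝ}
    (hc : ∀ ω, 0 ≤ c ω) (hp : ∑ ω, c ω * p.1 ω ≤ 1)
    (h : ∀ μ : Belief Ω, s < V μ → 1 < ∑ ω, c ω * μ.1 ω) (hs : s < valueMD VV p) :
    valueMD VV p < valueBP VV p := by
  obtain ⟨s₁, hs₁, hs₁'⟩ := exists_between hs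
  obtain ⟨s₂, hs₂, hs₂'⟩ := exists_between hs₁
  obtain ⟨η, hη, hη'⟩ := exists_pos_forall_add_le hV (continuous_sum_mul c) (a := s₂) (b := 1)
    fun μ hμ => h μ (hs₂.trans_le hμ)
  have hd : 0 < s₁ - s₂ := sub_pos.2 hs₂'
  -- Chosen so that `1 + η - K * (V μ - m) ^ 2` is nonpositive when `V μ < s₂` and `m > s₁`;
  -- integrating the bound `hpt` then gives variance at least `η / K`.
  set K := (1 + η) / (s₁ - s₂) ^ 2 with hK
  have hKpos : 0 < K := by positivity
  obtain ⟨μ₁, hM⟩ := exists_forall_le hV p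
  obtain ⟨μ₂, hm⟩ := exists_forall_le hV.neg p
  -- One over the range of `V`, plus one to avoid dividing by zero: the tilted density stays
  -- nonnegative for every `τ`, so the gain is uniform.
  set κ := 1 / (V μ₁ - V μ₂ + 1) with hκdef
  have hrange : 0 ≤ V μ₁ - V μ₂ := sub_nonneg.2 (hM μ₂)
  have hκ : 0 < κ := by positivity
  have hgain : ∀ τ ∈ bayesPlausible p,
      (∀ ω, ProbabilityTheory.covariance V (fun μ => μ.1 ω) τ = 0) → s₁ < ∫ μ, V μ ∂τ →
      ∫ μ, V μ ∂τ + κ * (η / K) ≤ valueBP VV p := by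
    intro τ hτ hcov hlt
    have := hτ.1
    have hle := integral_le_of_forall_le hV hM hτ
    refine le_trans ?_ (integral_add_variance_le_valueBP hVV hV hτ hcov (κ := κ) ?_)
    · set m := ∫ μ, V μ ∂τ
      have hpt : ∀ μ : Belief Ω, 1 + η - K * (V μ - m) ^ 2 ≤ ∑ ω, c ω * μ.1 ω := by
        intro μ
        by_cases hμ : s₂ ≤ V μ
        · have := hη' μ hμ
          have := mul_nonneg hKpos.le (sq_nonneg (V μ - m))
          linarith
        · push Not at hμ
          have h1 : (s₁ - s₂) ^ 2 ≤ (V μ - m) ^ 2 := by nlinarith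
          have h2 : K * (s₁ - s₂) ^ 2 = 1 + η := by
            rw [hK]
            field_simp
          have h3 : (0 : ℝ) ≤ ∑ ω, c ω * μ.1 ω :=
            Finset.sum_nonneg fun ω _ => mul_nonneg (hc ω) (μ.2.1 ω)
          have := mul_le_mul_of_nonneg_left h1 hKpos.le
          linarith
      have hint := integral_mono (integrable_of_continuous (by fun_prop) τ)
        (integrable_of_continuous (continuous_sum_mul c) τ) hpt
      rw [integral_sum_mul c hτ, integral_sub (integrable_const _)
        (integrable_of_continuous (by fun_prop) τ), integral_const_mul] at hint
      simp at hint
      have : η / K ≤ ∫ μ, (V μ - m) ^ 2 ∂τ := by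
        rw [div_le_iff₀ hKpos]
        linarith
      gcongr
    · intro μ
      have h1 : V μ₂ ≤ V μ := by
        have := hm μ
        simpa using this
      have h2 : -(1 : ℝ) ≤ κ * (V μ - ∫ ν, V ν ∂τ) := by
        rw [hκdef, one_div, inv_mul_eq_div, le_div_iff₀ (by positivity)]
        linarith
      linarith
  have hgap : 0 < κ * (η / K) := by positivity
  obtain ⟨τ, hτ, hcov, hlt⟩ := exists_lt_integral_of_lt_valueMD hVV hV (p := p)
    (c := max s₁ (valueMD VV p - κ * (η / K))) (max_lt hs₁' (by linarith))
  have := hgain τ hτ hcov ((le_max_left _ _).trans_lt hlt)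
  have := (le_max_right _ _).trans_lt hlt
  linarith

/-- Beliefs `y ω` worth `s`, one on each ray from the prior towards a vertex, can be added to any
weighted family of beliefs to make it Bayes plausible. Hence the family witnesses a gain from
mediation over `s` as soon as its payoff-weighted barycenter, net of `s`, is the prior. -/
theorem lt_valueMD_of_weights [DecidableEq Ω] (hVV : ∀ μ, VV μ = {V μ}) (hV : Continuous V)
    {s : ℝ} (hp : ∀ ω, 0 < p.1 ω) {y : Ω → Belief Ω} {t : Ω → ℝ} (ht : ∀ ω, 0 < t ω)
    (hy : ∀ ω ω', (y ω).1 ω' = p.1 ω' + t ω * ((dirac ω).1 ω' - p.1 ω'))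
    (hys : ∀ ω, V (y ω) = s)
    {ι : Type*} [Fintype ι] {α : ι → ℝ} (hα : ∀ i, 0 ≤ α i) {q : ι → Belief Ω}
    (hq : ∀ ω, ∑ i, α i * (V (q i) - s) * ((q i).1 ω - p.1 ω) = 0)
    (hpos : 0 < ∑ i, α i * (V (q i) - s)) : s < valueMD VV p := by
  set u : Ω → ℝ := fun ω => ∑ i, α i * (q i).1 ω with hu
  obtain ⟨κ, hκ, hκu⟩ : ∃ κ > 0, ∀ ω, κ * u ω ≤ p.1 ω / 2 := by
    have : ∀ᶠ κ : ℝ in nhdsWithin 0 (Ioi 0), ∀ ω, κ * u ω < p.1 ω / 2 := by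
      rw [Filter.eventually_all]
      intro ω
      have hc : Filter.Tendsto (fun κ : ℝ => κ * u ω) (nhdsWithin 0 (Ioi 0)) (nhds (0 * u ω)) :=
        ((continuous_id.mul continuous_const).tendsto 0).mono_left nhdsWithin_le_nhds
      rw [zero_mul] at hc
      exact hc.eventually_lt_const (half_pos (hp ω))
    obtain ⟨κ, h1, h2⟩ := (this.and self_mem_nhdsWithin).exists
    exact ⟨κ, h2, fun ω => (h1 ω).le⟩
  -- The weights on `y` cancel the displacement `κ * (u - (∑ α) p)` of the family, because `y ω - p`
  -- is `t ω` times `δ_ω - p`. Full support and small `κ` keep them positive.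
  set w : ι ⊕ Ω → ℝ := Sum.elim (fun i => κ * α i) fun ω => (p.1 ω - κ * u ω) / t ω with hw
  set Q : ι ⊕ Ω → Belief Ω := Sum.elim q y with hQ
  have hw0 : ∀ j, 0 ≤ w j := by
    rintro (i | ω)
    · exact mul_nonneg hκ.le (hα i)
    · have := hκu ω
      have := hp ω
      exact div_nonneg (by linarith) (ht ω).le
  obtain ⟨ω₁⟩ : Nonempty Ω := by
    by_contra hne
    rw [not_nonempty_iff] at hne
    have := p.2.2
    simp at this
  set S := ∑ j, w j with hS
  have hSpos : 0 < S := by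
    refine Finset.sum_pos' (fun j _ => hw0 j) ⟨Sum.inr ω₁, Finset.mem_univ _, ?_⟩
    have := hκu ω₁
    have := hp ω₁
    exact div_pos (by linarith) (ht ω₁)
  have hbary : ∀ ω', ∑ j, w j * ((Q j).1 ω' - p.1 ω') = 0 := by
    intro ω'
    rw [Fintype.sum_sum_type]
    simp only [hw, hQ, Sum.elim_inl, Sum.elim_inr]
    have h1 : ∀ ω, (p.1 ω - κ * u ω) / t ω * ((y ω).1 ω' - p.1 ω') =
        (p.1 ω - κ * u ω) * (dirac ω).1 ω' - (p.1 ω - κ * u ω) * p.1 ω' := by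
      intro ω
      have := (ht ω).ne'
      rw [hy]
      field_simp
      ring
    have h2 : ∑ ω, (p.1 ω - κ * u ω) * (dirac ω).1 ω' = p.1 ω' - κ * u ω' := by
      simp [Pi.single_apply]
    have h3 : ∑ ω, u ω = ∑ i, α i := by
      rw [hu, Finset.sum_comm]
      refine Finset.sum_congr rfl fun i _ => ?_
      rw [← Finset.mul_sum, (q i).2.2, mul_one]
    have h4 : ∑ ω, (p.1 ω - κ * u ω) = 1 - κ * ∑ i, α i := by
      rw [Finset.sum_sub_distrib, ← Finset.mul_sum, h3, p.2.2]
    have h5 : ∑ i, κ * α i * ((q i).1 ω' - p.1 ω') = κ * u ω' - κ * (∑ i, α i) * p.1 ω' := by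
      rw [hu, Finset.mul_sum, Finset.mul_sum, Finset.sum_mul, ← Finset.sum_sub_distrib]
      exact Finset.sum_congr rfl fun i _ => by ring
    rw [Finset.sum_congr rfl fun ω _ => h1 ω, Finset.sum_sub_distrib, h2, ← Finset.sum_mul, h4, h5]
    ring
  have hnorm : ∑ j, w j / S = 1 := by
    rw [← Finset.sum_div, ← hS, div_self hSpos.ne']
  have hmean : ∀ ω', ∑ j, w j / S * (Q j).1 ω' = p.1 ω' := by
    intro ω'
    have h1 : ∑ j, w j / S * (Q j).1 ω' =
        (∑ j, w j * ((Q j).1 ω' - p.1 ω')) / S + (∑ j, w j / S) * p.1 ω' := by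
      rw [Finset.sum_div, Finset.sum_mul, ← Finset.sum_add_distrib]
      exact Finset.sum_congr rfl fun j _ => by ring
    rw [h1, hbary, hnorm]
    ring
  have hwS : ∀ j, 0 ≤ w j / S := fun j => div_nonneg (hw0 j) hSpos.le
  have hmem := finiteMix_mem_bayesPlausible (q := Q) hwS hnorm hmean
  have := hmem.1
  have hval : ∫ μ, V μ ∂(finiteMix (fun j => w j / S) Q) =
      s + κ * (∑ i, α i * (V (q i) - s)) / S := by
    rw [integral_finiteMix hwS hV]
    have h1 : ∑ j, w j / S * V (Q j) = (∑ j, w j / S) * s + (∑ j, w j * (V (Q j) - s)) / S := by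
      rw [Finset.sum_div, Finset.sum_mul, ← Finset.sum_add_distrib]
      exact Finset.sum_congr rfl fun j _ => by ring
    rw [h1, hnorm, Fintype.sum_sum_type]
    simp only [hw, hQ, Sum.elim_inl, Sum.elim_inr, hys, sub_self, mul_zero, Finset.sum_const_zero,
      Finset.mul_sum, one_mul, add_zero, mul_assoc]
  have hcov : ∀ ω, ProbabilityTheory.covariance V (fun μ => μ.1 ω)
      (finiteMix (fun j => w j / S) Q) = 0 := by
    intro ω
    rw [covariance_eq hV (continuous_apply_belief ω), hmem.2 ω, integral_finiteMix hwS hV,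
      integral_finiteMix (f := fun μ => V μ * μ.1 ω) hwS (hV.mul (continuous_apply_belief ω))]
    have h1 : ∑ j, w j * (V (Q j) - s) * ((Q j).1 ω - p.1 ω) = 0 := by
      rw [Fintype.sum_sum_type]
      simp only [hw, hQ, Sum.elim_inl, Sum.elim_inr, hys, sub_self, mul_zero, zero_mul,
        Finset.sum_const_zero, add_zero]
      have := hq ω
      rw [← mul_zero κ, ← this, Finset.mul_sum]
      exact Finset.sum_congr rfl fun j _ => by ring
    have h2 : ∑ j, w j / S * (V (Q j) * (Q j).1 ω) - (∑ j, w j / S * V (Q j)) * p.1 ω =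
        (∑ j, w j * (V (Q j) - s) * ((Q j).1 ω - p.1 ω)) / S
          + s * (∑ j, w j * ((Q j).1 ω - p.1 ω)) / S := by
      rw [Finset.sum_div, Finset.sum_mul, Finset.mul_sum, Finset.sum_div,
        ← Finset.sum_sub_distrib, ← Finset.sum_add_distrib]
      exact Finset.sum_congr rfl fun j _ => by ring
    rw [h2, h1, hbary]
    simp
  have := integral_le_valueMD hVV hV hmem hcov
  rw [hval] at this
  have : 0 < κ * (∑ i, α i * (V (q i) - s)) / S := by positivity
  linarith

end Bounds

/-! ### Strictly quasiconvex functions in dimensions one and two -/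

/-- A strictly quasiconvex function on `[0, 1]` that is not monotone and does not start above its
final value returns to its initial value exactly once. -/
theorem exists_unique_return {f : ℝ → ℝ} (hc : ContinuousOn f (Icc 0 1))
    (hq : StrictQuasiconvexOn (Icc 0 1) f) (h01 : f 0 ≤ f 1) (hm : ¬ MonotoneOn f (Icc 0 1)) :
    ∃ l ∈ Ioc (0 : ℝ) 1, f l = f 0 ∧ ∀ l' ∈ Ioc (0 : ℝ) 1, f l' = f 0 → l' = l := by
  have hbetween : ∀ {s t : ℝ}, 0 < s → s < t → t ≤ 1 → f s < max (f t) (f 0) := by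
    intro s t hs hst ht
    have ht0 : 0 < t := hs.trans hst
    have := hq.2 t ⟨ht0.le, ht⟩ 0 ⟨le_rfl, zero_le_one⟩ ht0.ne' (s / t)
      ⟨div_pos hs ht0, (div_lt_one ht0).2 hst⟩
    rwa [smul_zero, add_zero, smul_eq_mul, div_mul_cancel₀ _ ht0.ne'] at this
  obtain ⟨t, ht, hlt⟩ : ∃ t ∈ Icc (0 : ℝ) 1, f t < f 0 := by
    -- If `f` never went below `f 0`, the maximum in `hbetween` would always be the right endpoint's
    -- value and `f` would be monotone.
    by_contra! hge
    refine hm fun s hs t ht hst => ?_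
    rcases hst.eq_or_lt with rfl | hst
    · exact le_rfl
    rcases hs.1.eq_or_lt with rfl | hs0
    · exact hge t ht
    · have := hbetween hs0 hst ht.2
      rw [max_eq_left (hge t ht)] at this
      exact this.le
  have ht0 : 0 < t := ht.1.lt_of_ne (by rintro rfl; exact lt_irrefl _ hlt)
  obtain ⟨l, hl, hfl⟩ := intermediate_value_Icc ht.2
    (hc.mono (Icc_subset_Icc_left ht.1)) ⟨hlt.le, h01⟩
  have hl0 : 0 < l := ht0.trans_le hl.1
  refine ⟨l, ⟨hl0, hl.2⟩, hfl, fun l' hl' hfl' => ?_⟩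
  rcases lt_trichotomy l' l with h | h | h
  · have := hbetween hl'.1 h hl.2
    rw [hfl, hfl', max_self] at this
    exact absurd this (lt_irrefl _)
  · exact h
  · have := hbetween hl0 h hl'.2
    rw [hfl, hfl', max_self] at this
    exact absurd this (lt_irrefl _)

/-- In the plane, a strictly quasiconvex function that changes sign along a ray from the origin is
negative at a point of the ray, and positive at two points whose midpoint lies strictly between
the origin and that point. -/
theorem exists_pos_pair_neg_beyond {O : Set (ℝ × ℝ)} (hO : IsOpen O) {G : ℝ × ℝ → ℝ}
    (hG : ContinuousOn G O) (hq : StrictQuasiconvexOn O G) (h0 : ((0 : ℝ), (0 : ℝ)) ∈ O)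
    (h1 : ((1 : ℝ), (0 : ℝ)) ∈ O) (hG0 : G (0, 0) < 0) (hG1 : 0 < G (1, 0)) :
    ∃ a₁ a₂ b c : ℝ, 0 < a₁ ∧ a₁ < a₂ ∧ (a₂, (0 : ℝ)) ∈ O ∧ (a₁ + b, c) ∈ O ∧ (a₁ - b, -c) ∈ O ∧
      G (a₂, 0) < 0 ∧ 0 < G (a₁ + b, c) ∧ 0 < G (a₁ - b, -c) := by
  have hrow : ∀ {x y z c : ℝ}, (x, c) ∈ O → (z, c) ∈ O → x < y → y < z →
      (y, c) ∈ O ∧ G (y, c) < max (G (x, c)) (G (z, c)) := by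
    intro x y z c hx hz hxy hyz
    have hxz : 0 < z - x := by linarith
    have ht : (z - y) / (z - x) ∈ Ioo (0 : ℝ) 1 :=
      ⟨div_pos (by linarith) hxz, (div_lt_one hxz).2 (by linarith)⟩
    have he : ((z - y) / (z - x)) • (x, c) + (1 - (z - y) / (z - x)) • (z, c) = (y, c) := by
      ext
      · simp
        field_simp
        ring
      · simp
        ring
    have hmem := hq.1 hx hz ht.1.le (sub_nonneg.2 ht.2.le) (by ring)
    have hlt := hq.2 _ hx _ hz (by simp; linarith) _ ht
    rw [he] at hmem hlt
    exact ⟨hmem, hlt⟩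
  have hrow' : ∀ {x z c : ℝ}, (x, c) ∈ O → (z, c) ∈ O → ∀ y ∈ Icc x z, (y, c) ∈ O := by
    intro x z c hx hz y hy
    rcases hy.1.eq_or_lt with rfl | hxy
    · exact hx
    rcases hy.2.eq_or_lt with rfl | hyz
    · exact hz
    exact (hrow hx hz hxy hyz).1
  have hcat : ∀ z ∈ O, ContinuousAt G z := fun z hz => hG.continuousAt (hO.mem_nhds hz)
  obtain ⟨a, ha, hGa⟩ := intermediate_value_Icc (f := fun x : ℝ => G (x, 0)) zero_le_one
    (hG.comp (by fun_prop) (hrow' h0 h1)) ⟨hG0.le, hG1.le⟩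
  simp only at hGa
  have ha0 : 0 < a := ha.1.lt_of_ne (by rintro rfl; exact hG0.ne hGa)
  have ha1 : a < 1 := ha.2.lt_of_ne (by rintro rfl; exact hG1.ne' hGa)
  have haO := hrow' h0 h1 a ha
  obtain ⟨σ, hσ, hσa, hσa'⟩ : ∃ σ > 0, σ < a ∧ a + σ < 1 := by
    refine ⟨min a (1 - a) / 2, by have := lt_min ha0 (sub_pos.2 ha1); linarith, ?_, ?_⟩
    · have := min_le_left a (1 - a); linarith
    · have := min_le_right a (1 - a); linarith
  obtain ⟨hlO, hl⟩ := hrow h0 haO (sub_pos.2 hσa) (sub_lt_self a hσ)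
  rw [hGa, max_eq_right hG0.le] at hl
  obtain ⟨hrO, -⟩ := hrow h0 h1 (by linarith : 0 < a + σ) hσa'
  have hr : 0 < G (a + σ, 0) := by
    have := (hrow h0 hrO ha0 (lt_add_of_pos_right a hσ)).2
    rw [hGa] at this
    exact (lt_max_iff.1 this).resolve_left hG0.not_gt
  obtain ⟨ε, hε, ⟨hO1, hG₁⟩, ⟨hO2, hG2⟩, hO3, hO4⟩ : ∃ ε > 0,
      ((a + σ, ε) ∈ O ∧ 0 < G (a + σ, ε)) ∧ ((a - σ, ε) ∈ O ∧ G (a - σ, ε) < 0) ∧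
        (a + σ, -ε) ∈ O ∧ (a - σ, -ε) ∈ O := by
    have ht : ∀ {x : ℝ}, Filter.Tendsto (fun ε : ℝ => (x, ε)) (nhdsWithin 0 (Ioi 0))
        (nhds (x, 0)) := fun {x} =>
      (Continuous.tendsto (f := fun ε : ℝ => (x, ε)) (by fun_prop) 0).mono_left nhdsWithin_le_nhds
    have ht' : ∀ {x : ℝ}, Filter.Tendsto (fun ε : ℝ => (x, -ε)) (nhdsWithin 0 (Ioi 0))
        (nhds (x, 0)) := fun {x} => by
      have := (Continuous.tendsto (f := fun ε : ℝ => (x, -ε)) (by fun_prop) 0).mono_left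
        (nhdsWithin_le_nhds (s := Ioi 0))
      simpa using this
    have e := (((ht.eventually (hO.mem_nhds hrO)).and
        (ht.eventually ((hcat _ hrO).eventually_const_lt hr))).and
      (((ht.eventually (hO.mem_nhds hlO)).and
        (ht.eventually ((hcat _ hlO).eventually_lt_const hl))).and
      ((ht'.eventually (hO.mem_nhds hrO)).and (ht'.eventually (hO.mem_nhds hlO)))))
    obtain ⟨ε, h, hε⟩ := (e.and self_mem_nhdsWithin).exists
    exact ⟨ε, hε, h⟩
  -- A zero of `G` on the row at height `ε`. Its reflection through the zero `(a, 0)` must be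
  -- positive, as a midpoint value of zero lies strictly below the maximum of the two ends.
  obtain ⟨r, hr', hGr⟩ := intermediate_value_Icc (f := fun x : ℝ => G (x, ε))
    (by linarith : a - σ ≤ a + σ) (hG.comp (by fun_prop) (hrow' hO2 hO1)) ⟨hG2.le, hG₁.le⟩
  simp only at hGr
  have hr1 : a - σ < r := hr'.1.lt_of_ne (by rintro rfl; exact hG2.ne hGr)
  have hrO' := hrow' hO2 hO1 r hr'
  have hoO : (2 * a - r, -ε) ∈ O :=
    hrow' hO4 hO3 _ ⟨by linarith [hr'.2], by linarith [hr'.1]⟩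
  have ho : 0 < G (2 * a - r, -ε) := by
    have := hq.2 _ hrO' _ hoO (by simp; intro; linarith) (1 / 2) (by norm_num)
    have he : ((1 : ℝ) / 2) • (r, ε) + (1 - (1 : ℝ) / 2) • (2 * a - r, -ε) = (a, 0) := by
      ext
      · simp; ring
      · simp; ring
    rw [he, hGa, hGr] at this
    exact (lt_max_iff.1 this).resolve_left (lt_irrefl _)
  obtain ⟨δ, hδ, hδa, hδ1, hδ2, hδ3⟩ : ∃ δ > 0, δ < a ∧ (r + δ, ε) ∈ O ∧
      (2 * a - r - 3 * δ, -ε) ∈ O ∧ 0 < G (2 * a - r - 3 * δ, -ε) := by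
    have t1 : Filter.Tendsto (fun δ : ℝ => (r + δ, ε)) (nhdsWithin 0 (Ioi 0))
        (nhds (r, ε)) := by
      have := (Continuous.tendsto (f := fun δ : ℝ => (r + δ, ε)) (by fun_prop) 0).mono_left
        (nhdsWithin_le_nhds (s := Ioi 0))
      simpa using this
    have t2 : Filter.Tendsto (fun δ : ℝ => (2 * a - r - 3 * δ, -ε)) (nhdsWithin 0 (Ioi 0))
        (nhds (2 * a - r, -ε)) := by
      have := (Continuous.tendsto (f := fun δ : ℝ => (2 * a - r - 3 * δ, -ε))
        (by fun_prop) 0).mono_left (nhdsWithin_le_nhds (s := Ioi 0))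
      simpa using this
    have t3 : ∀ᶠ δ : ℝ in nhdsWithin 0 (Ioi 0), δ < a :=
      nhdsWithin_le_nhds (Iio_mem_nhds ha0)
    obtain ⟨δ, h, hδ⟩ := ((t3.and ((t1.eventually (hO.mem_nhds hrO')).and
      ((t2.eventually (hO.mem_nhds hoO)).and
        (t2.eventually ((hcat _ hoO).eventually_const_lt ho))))).and self_mem_nhdsWithin).exists
    exact ⟨δ, hδ, h⟩
  -- Moving the zero right by `δ` makes it positive, while moving its reflection left by `3 * δ`
  -- keeps it positive. The midpoint thus becomes `a - δ`, leaving room for the negative point `a -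
  -- δ / 2` before the zero `a`.
  refine ⟨a - δ, a - δ / 2, r - a + 2 * δ, ε, by linarith, by linarith, ?_⟩
  rw [show a - δ + (r - a + 2 * δ) = r + δ by ring,
    show a - δ - (r - a + 2 * δ) = 2 * a - r - 3 * δ by ring]
  refine ⟨hrow' h0 haO _ ⟨by linarith, by linarith⟩, hδ1, hδ2, ?_, ?_, hδ3⟩
  · have := (hrow h0 haO (by linarith : 0 < a - δ / 2) (by linarith)).2
    rwa [hGa, max_eq_right hG0.le] at this
  · have := (hrow hO2 hδ1 hr1 (lt_add_of_pos_right r hδ)).2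
    rw [hGr] at this
    exact (lt_max_iff.1 this).resolve_left hG2.not_gt

/-! ### Strictly quasiconvex functions of a moment -/

section Moment

variable {Ω : Type*} [Fintype Ω] {k : ℕ} {T : (Ω → ℝ) →ₗ[ℝ] (Fin k → ℝ)}
  {v : (Fin k → ℝ) → ℝ}

theorem continuous_moment_value (hv : ContinuousOn v (momentSet T)) :
    ContinuousOn (fun x => v (T x)) (stdSimplex ℝ Ω) :=
  hv.comp T.continuous_of_finiteDimensional.continuousOn (mapsTo_image _ _)

theorem continuous_belief_value (hc : ContinuousOn v (momentSet T)) :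
    Continuous fun μ : Belief Ω => v (T μ.1) :=
  (continuous_moment_value hc).comp_continuous continuous_subtype_val fun μ => μ.2

theorem StrictQuasiconvexOn.moment_lt (hv : StrictQuasiconvexOn (momentSet T) v) {x y : Ω → ℝ}
    (hx : x ∈ stdSimplex ℝ Ω) (hy : y ∈ stdSimplex ℝ Ω) (hxy : T x ≠ T y) {t : ℝ}
    (ht : t ∈ Ioo (0 : ℝ) 1) : v (T (t • x + (1 - t) • y)) < max (v (T x)) (v (T y)) := by
  rw [map_add, map_smul, map_smul]
  exact hv.2 _ (mem_image_of_mem _ hx) _ (mem_image_of_mem _ hy) hxy t ht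

/-- Strictness is only available between distinct moments; two beliefs with the same moment have
constant value on their segment. -/
theorem StrictQuasiconvexOn.convex_moment_le (hv : StrictQuasiconvexOn (momentSet T) v) (s : ℝ) :
    Convex ℝ {x | x ∈ stdSimplex ℝ Ω ∧ v (T x) ≤ s} := by
  rw [convex_iff_forall_pos]
  rintro x ⟨hx, hxs⟩ y ⟨hy, hys⟩ a b ha hb hab
  obtain rfl : b = 1 - a := by linarith
  refine ⟨convex_stdSimplex ℝ Ω hx hy ha.le hb.le hab, ?_⟩
  by_cases h : T x = T y
  · have : T (a • x + (1 - a) • y) = T y := by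
      rw [map_add, map_smul, map_smul, h, ← add_smul, hab, one_smul]
    rwa [this]
  · exact (hv.moment_lt hx hy h ⟨ha, by linarith⟩).le.trans (max_le hxs hys)

theorem mem_of_forall_dirac_mem [DecidableEq Ω] {C : Set (Ω → ℝ)} (hC : Convex ℝ C)
    (h : ∀ ω : Ω, (dirac ω).1 ∈ C) {x : Ω → ℝ} (hx : x ∈ stdSimplex ℝ Ω) : x ∈ C := by
  have : x = ∑ ω, x ω • (dirac ω).1 := by
    funext ω'
    simp [Finset.sum_apply, Pi.single_apply]
  rw [this]
  exact hC.sum_mem (fun ω _ => hx.1 ω) hx.2 fun ω _ => h ω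

/-- The vertices of a moment of dimension at least two do not all lie on one line. -/
theorem IsMoment.exists_dirac_notMem_line [DecidableEq Ω] (hT : IsMoment T) (hk : 2 ≤ k)
    (x e : Fin k → ℝ) : ∃ ω : Ω, ∀ a : ℝ, T (dirac ω).1 ≠ x + a • e := by
  by_contra! h
  set L := AffineSubspace.mk' x (Submodule.span ℝ {e}) with hL
  have hsub : momentSet T ⊆ L := by
    rintro _ ⟨y, hy, rfl⟩
    refine mem_of_forall_dirac_mem (C := T ⁻¹' (L : Set (Fin k → ℝ)))
      (L.convex.linear_preimage T) (fun ω => ?_) hy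
    obtain ⟨a, ha⟩ := h ω
    rw [mem_preimage, ha, hL, SetLike.mem_coe, AffineSubspace.mem_mk', vsub_eq_sub,
      add_sub_cancel_left]
    exact Submodule.smul_mem _ _ (Submodule.mem_span_singleton_self e)
  have htop : L = ⊤ := by
    rw [eq_top_iff, ← hT]
    exact affineSpan_le.2 hsub
  have hdir : Submodule.span ℝ {e} = (⊤ : Submodule ℝ (Fin k → ℝ)) := by
    rw [← AffineSubspace.direction_mk' x (Submodule.span ℝ {e}), ← hL, htop,
      AffineSubspace.direction_top]
  have h1 := finrank_span_le_card (R := ℝ) ({e} : Set (Fin k → ℝ))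
  rw [hdir, finrank_top, Module.finrank_fin_fun] at h1
  simp at h1
  omega

/-- On the segment from a prior worth less than `s` to a vertex worth at least `s` there is a
belief worth exactly `s`. -/
theorem exists_belief_toward_dirac [DecidableEq Ω] (hc : ContinuousOn v (momentSet T))
    {p : Belief Ω} {s : ℝ} (hp : v (T p.1) < s) {ω : Ω} (hω : s ≤ v (T (dirac ω).1)) :
    ∃ (y : Belief Ω) (t : ℝ), 0 < t ∧ v (T y.1) = s ∧
      ∀ ω', y.1 ω' = p.1 ω' + t * ((dirac ω).1 ω' - p.1 ω') := by
  have hmem : ∀ t ∈ Icc (0 : ℝ) 1, (1 - t) • p.1 + t • (dirac ω).1 ∈ stdSimplex ℝ Ω :=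
    fun t ht => convex_stdSimplex ℝ Ω p.2 (dirac ω).2 (sub_nonneg.2 ht.2) ht.1 (by ring)
  obtain ⟨t, ht, hvt⟩ := intermediate_value_Icc
    (f := fun t : ℝ => v (T ((1 - t) • p.1 + t • (dirac ω).1))) zero_le_one
    ((continuous_moment_value hc).comp (by fun_prop) hmem)
    (by
      simp only [sub_zero, one_smul, zero_smul, add_zero, sub_self, zero_add]
      exact ⟨hp.le, hω⟩)
  refine ⟨⟨_, hmem t ht⟩, t, ht.1.lt_of_ne ?_, hvt, fun ω' => ?_⟩
  · rintro rfl
    simp only [sub_zero, one_smul, zero_smul, add_zero] at hvt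
    exact hp.ne hvt
  · simp only [Pi.add_apply, Pi.smul_apply, smul_eq_mul]
    ring

end Moment

/-! ### Gains from mediation and full dimensionality for moment values -/

section MomentValues

variable {Ω : Type*} [Fintype Ω] [DecidableEq Ω] {k : ℕ} {T : (Ω → ℝ) →ₗ[ℝ] (Fin k → ℝ)}
  {v : (Fin k → ℝ) → ℝ} {VV : Belief Ω → Set ℝ} {p : Belief Ω} {s : ℝ}

/-- If the full-support prior is worth less than `s` and every vertex at least `s`, then mediation
is worth more than `s` as soon as some belief is. -/
theorem lt_valueMD_of_moment (hVV : ∀ μ, VV μ = {v (T μ.1)}) (hT : IsMoment T) (hk : 2 ≤ k)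
    (hc : ContinuousOn v (momentSet T)) (hv : StrictQuasiconvexOn (momentSet T) v)
    (hp : ∀ ω, 0 < p.1 ω) (hps : v (T p.1) < s) (hs : ∀ ω : Ω, s ≤ v (T (dirac ω).1))
    (hex : ∃ q : Belief Ω, s < v (T q.1)) : s < valueMD VV p := by
  choose y t ht hys hy using fun ω => exists_belief_toward_dirac hc hps (hs ω)
  have hV := continuous_belief_value hc
  -- A small move towards the prior gives full support and keeps the value above `s`. The point then
  -- lies in the open domain `O` of the planar problem.
  obtain ⟨q₁, hq₁, hq₁s⟩ : ∃ q : Belief Ω, (∀ ω, 0 < q.1 ω) ∧ s < v (T q.1) := by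
    obtain ⟨q, hq⟩ := hex
    have hmem : ∀ r ∈ Icc (0 : ℝ) 1, (1 - r) • q.1 + r • p.1 ∈ stdSimplex ℝ Ω :=
      fun r hr => convex_stdSimplex ℝ Ω q.2 p.2 (sub_nonneg.2 hr.2) hr.1 (by ring)
    have hcont : ContinuousOn (fun r : ℝ => v (T ((1 - r) • q.1 + r • p.1))) (Icc 0 1) :=
      (continuous_moment_value hc).comp (by fun_prop) hmem
    have h0 := (hcont 0 ⟨le_rfl, zero_le_one⟩).mono_left
      (nhdsWithin_mono 0 (Ioo_subset_Icc_self))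
    have h1 : s < v (T ((1 - (0 : ℝ)) • q.1 + (0 : ℝ) • p.1)) := by simpa using hq
    have hne : (nhdsWithin (0 : ℝ) (Ioo 0 1)).NeBot := by
      rw [nhdsWithin_Ioo_eq_nhdsGT one_pos]
      infer_instance
    obtain ⟨r, hr, hr01⟩ := ((h0.eventually_const_lt h1).and self_mem_nhdsWithin).exists
    refine ⟨⟨_, hmem r ⟨hr01.1.le, hr01.2.le⟩⟩, fun ω => ?_, hr⟩
    have h2 : 0 ≤ (1 - r) * q.1 ω := mul_nonneg (by linarith [hr01.2]) (q.2.1 ω)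
    have h3 : 0 < r * p.1 ω := mul_pos hr01.1 (hp ω)
    simp only [Pi.add_apply, Pi.smul_apply, smul_eq_mul]
    linarith
  obtain ⟨ω₁, hω₁⟩ := hT.exists_dirac_notMem_line hk (T p.1) (T (q₁.1 - p.1))
  set e : Ω → ℝ := q₁.1 - p.1 with he
  set d : Ω → ℝ := (dirac ω₁).1 - p.1 with hd
  have hd' : ∀ a : ℝ, T d ≠ a • T e := by
    intro a ha
    apply hω₁ a
    rw [← ha, ← map_add, hd, add_sub_cancel]
  have he' : T e ≠ 0 := by
    intro h
    have : T q₁.1 = T p.1 := by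
      rw [← sub_eq_zero, ← map_sub]
      exact h
    rw [this] at hq₁s
    exact hps.not_gt hq₁s
  -- Planar coordinates with the prior at the origin and `q₁` at `(1, 0)`. As `T e` and `T d` are
  -- independent, strict quasiconvexity passes to the plane.
  set L : ℝ × ℝ → Ω → ℝ := fun z => p.1 + z.1 • e + z.2 • d with hL
  have hLc : Continuous L := by fun_prop
  have hLsum : ∀ z, ∑ ω, L z ω = 1 := by
    intro z
    simp only [hL, he, hd, Pi.add_apply, Pi.smul_apply, Pi.sub_apply, smul_eq_mul,
      Finset.sum_add_distrib, ← Finset.mul_sum, Finset.sum_sub_distrib, p.2.2, q₁.2.2,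
      (dirac ω₁).2.2]
    ring
  have hLcomb : ∀ (z z' : ℝ × ℝ) (a b : ℝ), a + b = 1 →
      L (a • z + b • z') = a • L z + b • L z' := by
    intro z z' a b hab
    obtain rfl : b = 1 - a := by linarith
    funext ω
    simp only [hL, Pi.add_apply, Pi.smul_apply, Prod.fst_add, Prod.snd_add, Prod.smul_fst,
      Prod.smul_snd, smul_eq_mul]
    ring
  set O : Set (ℝ × ℝ) := {z | ∀ ω, 0 < L z ω} with hO
  have hOopen : IsOpen O := by
    have : O = ⋂ ω, {z | 0 < L z ω} := by
      ext z
      simp [hO]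
    rw [this]
    exact isOpen_iInter_of_finite fun ω =>
      isOpen_lt continuous_const ((continuous_apply ω).comp hLc)
  have hOmem : ∀ z ∈ O, L z ∈ stdSimplex ℝ Ω := fun z hz => ⟨fun ω => (hz ω).le, hLsum z⟩
  have hOconv : Convex ℝ O := by
    rw [convex_iff_forall_pos]
    intro z hz z' hz' a b ha hb hab ω
    rw [hLcomb z z' a b hab]
    exact add_pos (mul_pos ha (hz ω)) (mul_pos hb (hz' ω))
  have hLinj : ∀ z z' : ℝ × ℝ, z ≠ z' → T (L z) ≠ T (L z') := by
    intro z z' hne h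
    have h1 : (z.2 - z'.2) • T d = (z'.1 - z.1) • T e := by
      simp only [hL, map_add, map_smul] at h
      rw [sub_smul, sub_smul]
      have : z.1 • T e + z.2 • T d = z'.1 • T e + z'.2 • T d := by
        rw [add_assoc, add_assoc] at h
        exact add_left_cancel h
      rw [sub_eq_sub_iff_add_eq_add, add_comm (z.2 • T d), this]
    by_cases h2 : z.2 - z'.2 = 0
    · rw [h2, zero_smul, eq_comm, smul_eq_zero] at h1
      rcases h1 with h1 | h1
      · exact hne (Prod.ext (by linarith) (by linarith))
      · exact he' h1
    · refine hd' ((z.2 - z'.2)⁻¹ * (z'.1 - z.1)) ?_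
      rw [mul_smul, ← h1, smul_smul, inv_mul_cancel₀ h2, one_smul]
  have hL0 : L (0, 0) = p.1 := by simp [hL]
  have hL1 : L (1, 0) = q₁.1 := by simp [hL, he]
  have hGc : ContinuousOn (fun z => v (T (L z)) - s) O :=
    ((continuous_moment_value hc).comp hLc.continuousOn hOmem).sub continuousOn_const
  have hGq : StrictQuasiconvexOn O fun z => v (T (L z)) - s := by
    refine ⟨hOconv, fun z hz z' hz' hne r hr => ?_⟩
    simp only [hLcomb z z' r (1 - r) (by ring)]
    have := hv.moment_lt (hOmem z hz) (hOmem z' hz') (hLinj z z' hne) hr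
    rw [max_sub_sub_right]
    linarith
  obtain ⟨a₁, a₂, b, c, ha₁, ha₂, h2O, hpO, hmO, h2neg, hppos, hmpos⟩ :=
    exists_pos_pair_neg_beyond hOopen hGc hGq
      (by intro ω; rw [hL0]; exact hp ω) (by intro ω; rw [hL1]; exact hq₁ ω)
      (by simp only [hL0]; linarith) (by simp only [hL1]; linarith)
  set W₂ := v (T (L (a₂, 0))) - s with hW₂
  set Wp := v (T (L (a₁ + b, c))) - s with hWp
  set Wm := v (T (L (a₁ - b, -c))) - s with hWm
  have h₂ : 2 * a₁ / -W₂ * W₂ = -(2 * a₁) := by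
    rw [div_neg, neg_mul, div_mul_cancel₀ _ h2neg.ne]
  have hP : a₂ / Wp * Wp = a₂ := div_mul_cancel₀ _ hppos.ne'
  have hM : a₂ / Wm * Wm = a₂ := div_mul_cancel₀ _ hmpos.ne'
  have ha₂' : 0 < a₂ := ha₁.trans ha₂
  -- After multiplication by the net values the weights are `-2 * a₁`, `a₂`, `a₂`: the barycenter
  -- balances as the pair has midpoint `a₁`, and the total `2 * (a₂ - a₁)` is positive.
  refine lt_valueMD_of_weights (ι := Fin 3) (V := fun μ => v (T μ.1)) hVV hV hp ht hy hys
    (α := ![2 * a₁ / -W₂, a₂ / Wp, a₂ / Wm])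
    (q := ![⟨_, hOmem _ h2O⟩, ⟨_, hOmem _ hpO⟩, ⟨_, hOmem _ hmO⟩]) ?_ ?_ ?_
  · intro i
    fin_cases i
    · exact div_nonneg (by linarith) (by linarith)
    · exact div_nonneg ha₂'.le hppos.le
    · exact div_nonneg ha₂'.le hmpos.le
  · intro ω
    simp only [Fin.sum_univ_three, Matrix.cons_val_zero, Matrix.cons_val_one, Matrix.cons_val]
    rw [← hW₂, ← hWp, ← hWm, h₂, hP, hM]
    simp only [hL, Pi.add_apply, Pi.smul_apply, smul_eq_mul]
    ring
  · simp only [Fin.sum_univ_three, Matrix.cons_val_zero, Matrix.cons_val_one, Matrix.cons_val]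
    rw [← hW₂, ← hWp, ← hWm, h₂, hP, hM]
    linarith

/-- If the full-support prior is worth less than `s`, every vertex at least `s`, and cheap talk at
most `s`, then cheap talk is worth exactly `s` and full dimensionality holds. -/
theorem fullDimensionality_of_moment (hVV : ∀ μ, VV μ = {v (T μ.1)})
    (hc : ContinuousOn v (momentSet T)) (hp : ∀ ω, 0 < p.1 ω) (hps : v (T p.1) < s)
    (hs : ∀ ω : Ω, s ≤ v (T (dirac ω).1)) (hCT : valueCT VV p ≤ s) :
    valueCT VV p = s ∧ FullDimensionality VV p := by
  choose y t ht hys hy using fun ω => exists_belief_toward_dirac hc hps (hs ω)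
  have hV := continuous_belief_value hc
  set S := ∑ ω, p.1 ω / t ω with hS
  have hw : ∀ ω, 0 < p.1 ω / t ω := fun ω => div_pos (hp ω) (ht ω)
  obtain ⟨ω₁⟩ : Nonempty Ω := by
    by_contra hne
    rw [not_nonempty_iff] at hne
    have := p.2.2
    simp at this
  have hSpos : 0 < S := Finset.sum_pos (fun ω _ => hw ω) ⟨ω₁, Finset.mem_univ _⟩
  have ha : ∀ ω, 0 < p.1 ω / t ω / S := fun ω => div_pos (hw ω) hSpos
  have hsum : ∑ ω, p.1 ω / t ω / S = 1 := by
    rw [← Finset.sum_div, ← hS, div_self hSpos.ne']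
  have hmean : ∀ ω', ∑ ω, p.1 ω / t ω / S * (y ω).1 ω' = p.1 ω' := by
    intro ω'
    have h1 : ∀ ω, p.1 ω / t ω / S * (y ω).1 ω' = p.1 ω / t ω / S * p.1 ω' +
        (p.1 ω * (dirac ω).1 ω' - p.1 ω * p.1 ω') / S := by
      intro ω
      have := (ht ω).ne'
      rw [hy]
      field_simp
    have h2 : ∑ ω, p.1 ω * (dirac ω).1 ω' = p.1 ω' := by
      simp [Pi.single_apply]
    rw [Finset.sum_congr rfl fun ω _ => h1 ω, Finset.sum_add_distrib, ← Finset.sum_mul, hsum,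
      ← Finset.sum_div, Finset.sum_sub_distrib, h2, ← Finset.sum_mul, p.2.2]
    ring
  have hmem := finiteMix_mem_bayesPlausible (q := y) (fun ω => (ha ω).le) hsum hmean
  have hsupp := support_finiteMix (q := y) ha
  have hval : ∀ μ ∈ (finiteMix (fun ω => p.1 ω / t ω / S) y).support, v (T μ.1) = s := by
    rw [hsupp]
    rintro _ ⟨ω, rfl⟩
    exact hys ω
  have hconst : ∀ μ ∈ (finiteMix (fun ω => p.1 ω / t ω / S) y).support,
      ∀ ν ∈ (finiteMix (fun ω => p.1 ω / t ω / S) y).support, v (T μ.1) = v (T ν.1) :=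
    fun μ hμ ν hν => (hval μ hμ).trans (hval ν hν).symm
  have hCTeq : valueCT VV p = s := by
    refine le_antisymm hCT ?_
    have := hmem.1
    rw [← integral_eq_of_forall_mem_support hval]
    exact integral_le_valueCT hVV hV hmem hconst
  refine ⟨hCTeq, ?_⟩
  unfold FullDimensionality cheapTalkHull
  rw [hCTeq]
  apply Subset.antisymm
  · exact iUnion₂_subset fun _ _ => inter_subset_right
  · refine subset_iUnion₂_of_subset (finiteMix (fun ω => p.1 ω / t ω / S) y)
      ⟨⟨_, hmem, isSelection_of_singleton hVV hV, hconst⟩, ?_, ?_⟩ ?_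
    · rw [hsupp]
      exact finite_range y
    · intro μ hμ
      rw [hVV, mem_singleton_iff, hval μ hμ]
    · intro x hx
      refine ⟨?_, hx⟩
      rw [hsupp]
      set A := affineSpan ℝ ((fun μ : Belief Ω => μ.1) '' range y) with hA
      have hyA : ∀ ω, (y ω).1 ∈ A := fun ω =>
        subset_affineSpan ℝ _ ⟨y ω, mem_range_self ω, rfl⟩
      have hpA : p.1 ∈ A := by
        have : p.1 = ∑ ω, (p.1 ω / t ω / S) • (y ω).1 := by
          funext ω'
          rw [← hmean ω']
          simp [Finset.sum_apply]
        rw [this]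
        exact A.convex.sum_mem (fun ω _ => (ha ω).le) hsum fun ω _ => hyA ω
      refine mem_of_forall_dirac_mem A.convex (fun ω => ?_) hx
      -- The vertex is recovered by extrapolating the line from the prior through `y ω`.
      have : (dirac ω).1 = AffineMap.lineMap p.1 (y ω).1 (1 / t ω) := by
        funext ω'
        have := (ht ω).ne'
        rw [AffineMap.lineMap_apply, vsub_eq_sub, vadd_eq_add, Pi.add_apply, Pi.smul_apply,
          Pi.sub_apply, hy, smul_eq_mul]
        field_simp
        ring
      rw [this]
      exact AffineMap.lineMap_mem _ hpA (hyA ω)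

end MomentValues

/-! ### The simplex of beliefs below the edges' return points -/

section EdgeSimplex

variable {Ω : Type*} [DecidableEq Ω]

/-- The coefficients of the half-space that cuts off the points `edgePoint ω₀ l ω`, `ω ≠ ω₀`. -/
def edgeCoeff (ω₀ : Ω) (l : Ω → ℝ) (ω : Ω) : ℝ := if ω = ω₀ then 0 else 1 / l ω

theorem edgeCoeff_nonneg {ω₀ : Ω} {l : Ω → ℝ} (hl : ∀ ω, l ω ∈ Ioc (0 : ℝ) 1) (ω : Ω) :
    0 ≤ edgeCoeff ω₀ l ω := by
  unfold edgeCoeff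
  split_ifs
  · exact le_rfl
  · exact div_nonneg zero_le_one (hl ω).1.le

variable [Fintype Ω]

/-- The point at distance `l ω` from `δ_{ω₀}` on the edge towards `δ_ω`. -/
def edgePoint (ω₀ : Ω) (l : Ω → ℝ) (ω : Ω) : Ω → ℝ :=
  l ω • (dirac ω).1 + (1 - l ω) • (dirac ω₀).1

variable {ω₀ : Ω} {l : Ω → ℝ}

theorem edgePoint_apply {ω ω' : Ω} (h : ω' ≠ ω₀) :
    edgePoint ω₀ l ω ω' = if ω = ω' then l ω else 0 := by
  simp only [edgePoint, Pi.add_apply, Pi.smul_apply, smul_eq_mul, Pi.single_apply, h, if_false,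
    mul_zero, add_zero, mul_ite, mul_one, eq_comm]

theorem edgePoint_mem (hl : ∀ ω, l ω ∈ Ioc (0 : ℝ) 1) (ω : Ω) :
    edgePoint ω₀ l ω ∈ stdSimplex ℝ Ω :=
  convex_stdSimplex ℝ Ω (dirac ω).2 (dirac ω₀).2 (hl ω).1.le (sub_nonneg.2 (hl ω).2) (by ring)

/-- Off `ω₀`, the coordinate `ω` is nonzero only at the edge point of `ω`, which kills every weight
but that of `ω₀`; the zero total kills the last. -/
theorem affineIndependent_edgePoint (hl : ∀ ω, l ω ∈ Ioc (0 : ℝ) 1) :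
    AffineIndependent ℝ (edgePoint ω₀ l) := by
  rw [affineIndependent_iff]
  intro s w hw hsum
  have hne : ∀ ω ∈ s, ω ≠ ω₀ → w ω = 0 := by
    intro ω hω hne
    have h := congrFun hsum ω
    simp only [Finset.sum_apply, Pi.smul_apply, smul_eq_mul, edgePoint_apply hne, Pi.zero_apply,
      mul_ite, mul_zero, Finset.sum_ite_eq', hω, if_true] at h
    exact (mul_eq_zero.1 h).resolve_right (hl ω).1.ne'
  intro ω hω
  by_cases h : ω = ω₀
  · subst h
    rw [← hw]
    exact (Finset.sum_eq_single_of_mem ω hω hne).symm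
  · exact hne ω hω h

theorem sum_edgeCoeff_edgePoint (hl : ∀ ω, l ω ∈ Ioc (0 : ℝ) 1) {ω : Ω} (h : ω ≠ ω₀) :
    ∑ ω', edgeCoeff ω₀ l ω' * edgePoint ω₀ l ω ω' = 1 := by
  rw [Finset.sum_eq_single_of_mem ω (Finset.mem_univ ω)]
  · rw [edgePoint_apply h, if_pos rfl, edgeCoeff, if_neg h, one_div,
      inv_mul_cancel₀ (hl ω).1.ne']
  · intro ω' _ hne
    by_cases h' : ω' = ω₀
    · rw [edgeCoeff, if_pos h', zero_mul]
    · rw [edgePoint_apply h', if_neg hne.symm, mul_zero]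

theorem sum_edgeCoeff_le_one_of_mem_convexHull (hl : ∀ ω, l ω ∈ Ioc (0 : ℝ) 1) {x : Ω → ℝ}
    (hx : x ∈ convexHull ℝ (range (edgePoint ω₀ l))) : ∑ ω, edgeCoeff ω₀ l ω * x ω ≤ 1 := by
  have hconv : Convex ℝ {x : Ω → ℝ | ∑ ω, edgeCoeff ω₀ l ω * x ω ≤ 1} := by
    refine convex_halfSpace_le (f := fun x : Ω → ℝ => ∑ ω, edgeCoeff ω₀ l ω * x ω) ⟨?_, ?_⟩ 1
    · intro x y
      simp only [Pi.add_apply, mul_add, Finset.sum_add_distrib]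
    · intro a x
      simp only [Pi.smul_apply, smul_eq_mul, Finset.mul_sum]
      exact Finset.sum_congr rfl fun ω _ => by ring
  refine convexHull_min ?_ hconv hx
  rintro _ ⟨ω, rfl⟩
  by_cases h : ω = ω₀
  · subst h
    refine (le_of_eq (Finset.sum_eq_zero fun ω' _ => ?_)).trans (zero_le_one' ℝ)
    by_cases h' : ω' = ω
    · rw [edgeCoeff, if_pos h', zero_mul]
    · rw [edgePoint_apply h', if_neg (Ne.symm h'), mul_zero]
  · exact (sum_edgeCoeff_edgePoint hl h).le

/-- The half-space cut off by the edge points contains only convex combinations of them. -/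
theorem mem_of_sum_edgeCoeff_le_one (hl : ∀ ω, l ω ∈ Ioc (0 : ℝ) 1) {C : Set (Ω → ℝ)}
    (hC : Convex ℝ C) (h : ∀ ω, edgePoint ω₀ l ω ∈ C) {x : Ω → ℝ} (hx : x ∈ stdSimplex ℝ Ω)
    (hx1 : ∑ ω, edgeCoeff ω₀ l ω * x ω ≤ 1) : x ∈ C := by
  -- Barycentric coordinates of `x`: the slack in the half-space inequality is the weight of
  -- `δ_{ω₀}`.
  set w : Ω → ℝ := fun ω => edgeCoeff ω₀ l ω * x ω +
    if ω = ω₀ then 1 - ∑ ω, edgeCoeff ω₀ l ω * x ω else 0 with hw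
  have hw0 : ∀ ω, 0 ≤ w ω := by
    intro ω
    refine add_nonneg (mul_nonneg (edgeCoeff_nonneg hl ω) (hx.1 ω)) ?_
    split_ifs
    · linarith
    · exact le_rfl
  have hw1 : ∑ ω, w ω = 1 := by
    rw [hw, Finset.sum_add_distrib, Finset.sum_ite_eq' Finset.univ ω₀]
    simp
  have hne : ∀ ω, ω ≠ ω₀ → (∑ i, w i • edgePoint ω₀ l i) ω = x ω := by
    intro ω hω
    have := (hl ω).1.ne'
    simp only [Finset.sum_apply, Pi.smul_apply, smul_eq_mul, edgePoint_apply hω, mul_ite, mul_zero,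
      Finset.sum_ite_eq', Finset.mem_univ, if_true, hw, edgeCoeff, hω, if_false, add_zero]
    field_simp
  have hmem : ∑ i, w i • edgePoint ω₀ l i ∈ stdSimplex ℝ Ω :=
    (convex_stdSimplex ℝ Ω).sum_mem (fun ω _ => hw0 ω) hw1 fun ω _ => edgePoint_mem hl ω
  have heq : x = ∑ i, w i • edgePoint ω₀ l i := by
    funext ω
    by_cases hω : ω = ω₀
    · subst hω
      have h1 := hx.2
      have h2 := hmem.2
      rw [← Finset.add_sum_erase _ _ (Finset.mem_univ ω)] at h1 h2
      rw [Finset.sum_congr rfl fun i hi => hne i (Finset.ne_of_mem_erase hi)] at h2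
      linarith
    · exact (hne ω hω).symm
  rw [heq]
  exact hC.sum_mem (fun ω _ => hw0 ω) hw1 fun ω _ => h ω

variable {k : ℕ} {T : (Ω → ℝ) →ₗ[ℝ] (Fin k → ℝ)} {v : (Fin k → ℝ) → ℝ}

/-- Beyond the edge points' common level, a belief lies outside the half-space they cut off. -/
theorem one_lt_sum_edgeCoeff (hv : StrictQuasiconvexOn (momentSet T) v)
    (hl : ∀ ω, l ω ∈ Ioc (0 : ℝ) 1) {s : ℝ} (hs : ∀ ω, v (T (edgePoint ω₀ l ω)) ≤ s)
    (μ : Belief Ω) (hμ : s < v (T μ.1)) : 1 < ∑ ω, edgeCoeff ω₀ l ω * μ.1 ω := by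
  by_contra! h
  exact hμ.not_ge (mem_of_sum_edgeCoeff_le_one hl (hv.convex_moment_le s)
    (fun ω => ⟨edgePoint_mem hl ω, hs ω⟩) μ.2 h).2

/-- Take two vertices whose moments are not collinear with that of `δ_{ω₀}`: equal moments of their
edge points would put all three on one line. -/
theorem exists_edgePoint_moment_ne (hT : IsMoment T) (hk : 2 ≤ k)
    (hl : ∀ ω, l ω ∈ Ioc (0 : ℝ) 1) :
    ∃ ω₁ ω₂, ω₁ ≠ ω₀ ∧ ω₂ ≠ ω₀ ∧ T (edgePoint ω₀ l ω₁) ≠ T (edgePoint ω₀ l ω₂) := by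
  obtain ⟨ω₁, h₁⟩ := hT.exists_dirac_notMem_line hk (T (dirac ω₀).1) 0
  obtain ⟨ω₂, h₂⟩ := hT.exists_dirac_notMem_line hk (T (dirac ω₀).1)
    (T (edgePoint ω₀ l ω₁) - T (dirac ω₀).1)
  refine ⟨ω₁, ω₂, ?_, ?_, fun h => ?_⟩
  · rintro rfl
    exact h₁ 0 (by simp)
  · rintro rfl
    exact h₂ 0 (by simp)
  · apply h₂ (1 / l ω₂)
    rw [h, edgePoint, map_add, map_smul, map_smul]
    have := (hl ω₂).1.ne'
    ext i
    simp only [Pi.add_apply, Pi.smul_apply, Pi.sub_apply, smul_eq_mul]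
    field_simp
    ring

/-- Full-support beliefs in the simplex spanned by the edge points are worth strictly less than
their common level. -/
theorem moment_lt_of_sum_edgeCoeff_le_one (hT : IsMoment T) (hk : 2 ≤ k)
    (hv : StrictQuasiconvexOn (momentSet T) v) (hl : ∀ ω, l ω ∈ Ioc (0 : ℝ) 1) {s : ℝ}
    (hs : ∀ ω, v (T (edgePoint ω₀ l ω)) ≤ s) {p : Belief Ω} (hp : ∀ ω, 0 < p.1 ω)
    (hp1 : ∑ ω, edgeCoeff ω₀ l ω * p.1 ω ≤ 1) : v (T p.1) < s := by
  obtain ⟨ω₁, ω₂, h₁, h₂, hne⟩ := exists_edgePoint_moment_ne (ω₀ := ω₀) hT hk hl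
  -- This direction is parallel to the bounding hyperplane, so small moves both ways from `p` stay
  -- in the half-space even if `p` is on its boundary.
  set d := edgePoint ω₀ l ω₁ - edgePoint ω₀ l ω₂ with hd
  have hd0 : T d ≠ 0 := by rwa [hd, map_sub, sub_ne_zero]
  have hdsum : ∑ ω, d ω = 0 := by
    simp only [hd, Pi.sub_apply, Finset.sum_sub_distrib]
    rw [(edgePoint_mem hl ω₁).2, (edgePoint_mem hl ω₂).2, sub_self]
  have hdc : ∑ ω, edgeCoeff ω₀ l ω * d ω = 0 := by
    simp only [hd, Pi.sub_apply, mul_sub, Finset.sum_sub_distrib]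
    rw [sum_edgeCoeff_edgePoint hl h₁, sum_edgeCoeff_edgePoint hl h₂, sub_self]
  obtain ⟨ε, hε, hpos, hneg⟩ : ∃ ε > 0, (∀ ω, 0 < p.1 ω + ε * d ω) ∧
      ∀ ω, 0 < p.1 ω + (-ε) * d ω := by
    have e : ∀ᶠ ε : ℝ in nhds 0, ∀ ω, 0 < p.1 ω + ε * d ω := by
      rw [Filter.eventually_all]
      intro ω
      have : ContinuousAt (fun ε : ℝ => p.1 ω + ε * d ω) 0 := by fun_prop
      exact this.eventually_const_lt (by simpa using hp ω)
    have e' : ∀ᶠ ε : ℝ in nhds 0, ∀ ω, 0 < p.1 ω + (-ε) * d ω :=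
      (continuous_neg.tendsto' (0 : ℝ) 0 neg_zero).eventually e
    have e'' : ∀ᶠ ε : ℝ in nhdsWithin 0 (Ioi 0), (∀ ω, 0 < p.1 ω + ε * d ω) ∧
        ∀ ω, 0 < p.1 ω + (-ε) * d ω := nhdsWithin_le_nhds (e.and e')
    obtain ⟨ε, h, hε⟩ := (e''.and self_mem_nhdsWithin).exists
    exact ⟨ε, hε, h⟩
  have hmem : ∀ r : ℝ, (∀ ω, 0 < p.1 ω + r * d ω) →
      p.1 + r • d ∈ {x | x ∈ stdSimplex ℝ Ω ∧ v (T x) ≤ s} := by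
    intro r hr
    refine mem_of_sum_edgeCoeff_le_one (ω₀ := ω₀) (l := l) hl (hv.convex_moment_le s)
      (fun ω => ⟨edgePoint_mem hl ω, hs ω⟩) ⟨fun ω => (hr ω).le, ?_⟩ ?_
    · simp only [Pi.add_apply, Pi.smul_apply, smul_eq_mul, Finset.sum_add_distrib,
        ← Finset.mul_sum, hdsum, p.2.2]
      ring
    · refine le_trans (le_of_eq ?_) hp1
      have : ∀ ω, edgeCoeff ω₀ l ω * (p.1 + r • d) ω =
          edgeCoeff ω₀ l ω * p.1 ω + r * (edgeCoeff ω₀ l ω * d ω) := by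
        intro ω
        simp only [Pi.add_apply, Pi.smul_apply, smul_eq_mul]
        ring
      rw [Finset.sum_congr rfl fun ω _ => this ω, Finset.sum_add_distrib, ← Finset.mul_sum, hdc]
      ring
  have hadd := hmem ε hpos
  have hsub := hmem (-ε) hneg
  have hT' : T (p.1 + ε • d) ≠ T (p.1 + (-ε) • d) := by
    intro h
    rw [map_add, map_add, map_smul, map_smul] at h
    have h3 := add_left_cancel h
    rw [neg_smul, eq_neg_iff_add_eq_zero, ← add_smul, smul_eq_zero] at h3
    exact h3.elim (fun h => by linarith) hd0
  have hlt := hv.moment_lt hadd.1 hsub.1 hT' (t := 1 / 2) (by norm_num)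
  have he : ((1 : ℝ) / 2) • (p.1 + ε • d) + (1 - (1 : ℝ) / 2) • (p.1 + (-ε) • d) = p.1 := by
    funext ω
    simp only [Pi.add_apply, Pi.smul_apply, smul_eq_mul]
    ring
  rw [he] at hlt
  exact hlt.trans_le (max_le hadd.2 hsub.2)

/-- A belief that gives positive probability to a state below the maximum of the value is itself
below that maximum. -/
theorem moment_lt_of_pos (hv : StrictQuasiconvexOn (momentSet T) v) {M : ℝ}
    (hM : ∀ μ : Belief Ω, v (T μ.1) ≤ M) (hω₀ : v (T (dirac ω₀).1) < M) (μ : Belief Ω)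
    (hμ : 0 < μ.1 ω₀) : v (T μ.1) < M := by
  by_cases hT : T μ.1 = T (dirac ω₀).1
  · rwa [hT]
  have h1 : μ.1 ω₀ < 1 := by
    refine lt_of_le_of_ne ?_ fun h => hT ?_
    · rw [← μ.2.2]
      exact Finset.single_le_sum (fun i _ => μ.2.1 i) (Finset.mem_univ ω₀)
    · congr 1
      have h0 := μ.2.2
      rw [← Finset.add_sum_erase _ _ (Finset.mem_univ ω₀), h, add_eq_left,
        Finset.sum_eq_zero_iff_of_nonneg fun i _ => μ.2.1 i] at h0
      funext ω
      by_cases hω : ω = ω₀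
      · rw [hω, h]
        simp
      · rw [h0 ω (Finset.mem_erase.2 ⟨hω, Finset.mem_univ ω⟩)]
        simp [hω]
  have h2 : (1 - μ.1 ω₀) ≠ 0 := (sub_pos.2 h1).ne'
  -- The belief `μ` conditioned on the state not being `ω₀`.
  set y : Ω → ℝ := (1 - μ.1 ω₀)⁻¹ • (μ.1 - μ.1 ω₀ • (dirac ω₀).1) with hy
  have hymem : y ∈ stdSimplex ℝ Ω := by
    refine ⟨fun ω => mul_nonneg (inv_nonneg.2 (sub_pos.2 h1).le) ?_, ?_⟩
    · by_cases hω : ω = ω₀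
      · simp [hω]
      · simpa [hω] using μ.2.1 ω
    · simp only [hy, Pi.smul_apply, Pi.sub_apply, smul_eq_mul, ← Finset.mul_sum,
        Finset.sum_sub_distrib, μ.2.2, (dirac ω₀).2.2, mul_one]
      exact inv_mul_cancel₀ h2
  have hcomb : μ.1 ω₀ • (dirac ω₀).1 + (1 - μ.1 ω₀) • y = μ.1 := by
    rw [hy, smul_smul, mul_inv_cancel₀ h2, one_smul, add_sub_cancel]
  have hne : T (dirac ω₀).1 ≠ T y := by
    intro h
    apply hT
    rw [← hcomb, map_add, map_smul, map_smul, ← h, ← add_smul, add_sub_cancel, one_smul]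
  have := hv.moment_lt (dirac ω₀).2 hymem hne ⟨hμ, h1⟩
  rw [hcomb] at this
  exact this.trans_le (max_le hω₀.le (hM ⟨y, hymem⟩))

/-- A minimally edge non-monotone value returns, on each edge, to its worst vertex value. -/
theorem MinimallyEdgeNonMonotone.exists_edge_return (he : MinimallyEdgeNonMonotone T v)
    (hc : ContinuousOn v (momentSet T)) (hv : StrictQuasiconvexOn (momentSet T) v) :
    ∃ (ω₀ : Ω) (l : Ω → ℝ), (∀ ω, v (T (dirac ω₀).1) ≤ v (T (dirac ω).1)) ∧
      (∀ ω, l ω ∈ Ioc (0 : ℝ) 1) ∧ ∀ ω, v (T (edgePoint ω₀ l ω)) = v (T (dirac ω₀).1) ∧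
        (T (dirac ω).1 ≠ T (dirac ω₀).1 → ∀ l' ∈ Ioc (0 : ℝ) 1,
          v (T (l' • (dirac ω).1 + (1 - l') • (dirac ω₀).1)) = v (T (dirac ω₀).1) → l' = l ω) := by
  obtain ⟨_, ⟨ω₀, rfl⟩, hmin, hedge⟩ := he
  have hmin' : ∀ ω, v (T (dirac ω₀).1) ≤ v (T (dirac ω).1) := fun ω => hmin _ ⟨ω, rfl⟩
  have key : ∀ ω, ∃ l ∈ Ioc (0 : ℝ) 1,
      v (T (l • (dirac ω).1 + (1 - l) • (dirac ω₀).1)) = v (T (dirac ω₀).1) ∧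
        (T (dirac ω).1 ≠ T (dirac ω₀).1 → ∀ l' ∈ Ioc (0 : ℝ) 1,
          v (T (l' • (dirac ω).1 + (1 - l') • (dirac ω₀).1)) = v (T (dirac ω₀).1) → l' = l) := by
    intro ω
    by_cases hω : T (dirac ω).1 = T (dirac ω₀).1
    -- The value is constant on such an edge, so any point would serve; this also covers `ω = ω₀`.
    · exact ⟨1, ⟨one_pos, le_rfl⟩, by simp only [sub_self, zero_smul, add_zero, one_smul, hω],
        fun h => absurd hω h⟩
    set γ : ℝ → Ω → ℝ := fun t => t • (dirac ω).1 + (1 - t) • (dirac ω₀).1 with hγ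
    have hγc : Continuous γ := by fun_prop
    have hγmem : ∀ t ∈ Icc (0 : ℝ) 1, γ t ∈ stdSimplex ℝ Ω := fun t ht =>
      convex_stdSimplex ℝ Ω (dirac ω).2 (dirac ω₀).2 ht.1 (sub_nonneg.2 ht.2) (by ring)
    have hγT : ∀ t, T (γ t) = t • T (dirac ω).1 + (1 - t) • T (dirac ω₀).1 := fun t => by
      rw [hγ, map_add, map_smul, map_smul]
    have hγ0 : γ 0 = (dirac ω₀).1 := by simp [hγ]
    have hγ1 : γ 1 = (dirac ω).1 := by simp [hγ]
    have hq : StrictQuasiconvexOn (Icc 0 1) fun t => v (T (γ t)) := by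
      refine ⟨convex_Icc 0 1, fun x hx y hy hxy t ht => ?_⟩
      have hcomb : γ (t • x + (1 - t) • y) = t • γ x + (1 - t) • γ y := by
        funext i
        simp only [hγ, Pi.add_apply, Pi.smul_apply, smul_eq_mul]
        ring
      simp only [hcomb]
      refine hv.moment_lt (hγmem x hx) (hγmem y hy) (fun h => ?_) ht
      have h3 : (x - y) • (T (dirac ω).1 - T (dirac ω₀).1) = 0 := by
        rw [hγT, hγT, ← sub_eq_zero] at h
        rw [← h]
        module
      rcases smul_eq_zero.1 h3 with h3 | h3
      · exact hxy (sub_eq_zero.1 h3)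
      · exact hω (sub_eq_zero.1 h3)
    obtain ⟨l, hl, hfl, huniq⟩ := exists_unique_return (f := fun t => v (T (γ t)))
      ((continuous_moment_value hc).comp hγc.continuousOn hγmem) hq
      (by simp only [hγ0, hγ1]; exact hmin' ω)
      (by
        have := (hedge _ ⟨ω, rfl⟩ hω).1
        simpa only [hγT] using this)
    simp only [hγ0] at hfl huniq
    exact ⟨l, hl, hfl, fun _ => huniq⟩
  choose l hl hval huniq using key
  exact ⟨ω₀, l, hmin', hl, fun ω => ⟨hval ω, huniq ω⟩⟩

end EdgeSimplex

end CheapTalk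

end

/-! ### The main theorem -/

theorem proposition6
    {Ω : Type*} [Fintype Ω] [DecidableEq Ω]
    {A : Type*} [MetricSpace A] [CompactSpace A]
    (uS : A → ℝ) (huS : Continuous uS)
    (uR : Ω → A → ℝ) (huR : ∀ ω, Continuous (uR ω))
    {k : ℕ} (hk : 2 ≤ k)
    (T : (Ω → ℝ) →ₗ[ℝ] (Fin k → ℝ)) (hT : CheapTalk.IsMoment T)
    (v : (Fin k → ℝ) → ℝ)
    (hV : ∀ μ : CheapTalk.Belief Ω, CheapTalk.indirectValue uS uR μ = {v (T μ.1)})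
    (hv_cont : ContinuousOn v (CheapTalk.momentSet T))
    (hv_qcvx : CheapTalk.StrictQuasiconvexOn (CheapTalk.momentSet T) v)
    (hv_edge : CheapTalk.MinimallyEdgeNonMonotone T v) :
    ∃ (ω₀ : Ω) (m : Ω → CheapTalk.Belief Ω),
      -- `ω₀` is a worst degenerate belief
      (∀ ω, v (T (CheapTalk.dirac ω₀).1) ≤ v (T (CheapTalk.dirac ω).1)) ∧
      -- the vertices of the simplex: `δ_{ω₀}` and, on each half-open edge `(δ_{ω₀}, δ_ω]`,
      -- the belief with the same value as `δ_{ω₀}`, which is unique if `T(δ_ω) ≠ T(δ_{ω₀})`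
      m ω₀ = CheapTalk.dirac ω₀ ∧
      (∀ ω, ω ≠ ω₀ → ∃ l ∈ Set.Ioc (0 : ℝ) 1,
        (m ω).1 = l • (CheapTalk.dirac ω).1 + (1 - l) • (CheapTalk.dirac ω₀).1 ∧
        v (T (m ω).1) = v (T (CheapTalk.dirac ω₀).1) ∧
        (T (CheapTalk.dirac ω).1 ≠ T (CheapTalk.dirac ω₀).1 → ∀ l' ∈ Set.Ioc (0 : ℝ) 1,
          v (T (l' • (CheapTalk.dirac ω).1 + (1 - l') • (CheapTalk.dirac ω₀).1))
            = v (T (CheapTalk.dirac ω₀).1) → l' = l)) ∧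
      -- they span an `(n - 1)`-simplex
      AffineIndependent ℝ (fun ω => (m ω).1) ∧
      -- for every full-support prior in this simplex
      ∀ p : CheapTalk.Belief Ω, p.1 ∈ convexHull ℝ (Set.range fun ω => (m ω).1) →
        (∀ ω, 0 < p.1 ω) →
        CheapTalk.FullDimensionality (CheapTalk.indirectValue uS uR) p ∧
        ((sSup (Set.range fun μ : CheapTalk.Belief Ω => v (T μ.1))
              > CheapTalk.valueBP (CheapTalk.indirectValue uS uR) p ∧
            CheapTalk.valueBP (CheapTalk.indirectValue uS uR) p
              > CheapTalk.valueMD (CheapTalk.indirectValue uS uR) p ∧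
            CheapTalk.valueMD (CheapTalk.indirectValue uS uR) p
              > CheapTalk.valueCT (CheapTalk.indirectValue uS uR) p ∧
            CheapTalk.valueCT (CheapTalk.indirectValue uS uR) p > v (T p.1)) ↔
          sInf (v '' CheapTalk.momentVertices T) < sSup (v '' CheapTalk.momentSet T)) := by
  obtain ⟨ω₀, l, hmin, hl, hedge⟩ := hv_edge.exists_edge_return hv_cont hv_qcvx
  have hpt : ∀ ω, v (T (CheapTalk.edgePoint ω₀ l ω)) ≤ v (T (CheapTalk.dirac ω₀).1) :=
    fun ω => (hedge ω).1.le
  refine ⟨ω₀, fun ω => ⟨CheapTalk.edgePoint ω₀ l ω, CheapTalk.edgePoint_mem hl ω⟩, hmin, ?_, ?_,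
    CheapTalk.affineIndependent_edgePoint hl, ?_⟩
  · refine Subtype.ext ?_
    simp only [CheapTalk.edgePoint]
    rw [← add_smul, add_sub_cancel, one_smul]
  · exact fun ω _ => ⟨l ω, hl ω, rfl, (hedge ω).1, (hedge ω).2⟩
  intro p hpD hp
  have hc := CheapTalk.continuous_belief_value hv_cont
  have hp1 := CheapTalk.sum_edgeCoeff_le_one_of_mem_convexHull hl hpD
  have hout := CheapTalk.one_lt_sum_edgeCoeff hv_qcvx hl hpt
  have hps := CheapTalk.moment_lt_of_sum_edgeCoeff_le_one hT hk hv_qcvx hl hpt hp hp1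
  obtain ⟨hCT, hfull⟩ := CheapTalk.fullDimensionality_of_moment hV hv_cont hp hps hmin
    (CheapTalk.valueCT_le_of_halfSpace hV hc (CheapTalk.edgeCoeff ω₀ l) hp1 hout)
  have hrange : Set.range (fun μ : CheapTalk.Belief Ω => v (T μ.1)) =
      v '' CheapTalk.momentSet T := by
    rw [CheapTalk.momentSet, Set.image_image]
    ext r
    simp
  have hinf : sInf (v '' CheapTalk.momentVertices T) = v (T (CheapTalk.dirac ω₀).1) := by
    refine IsLeast.csInf_eq ⟨⟨_, ⟨ω₀, rfl⟩, rfl⟩, ?_⟩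
    rintro _ ⟨_, ⟨ω, rfl⟩, rfl⟩
    exact hmin ω
  refine ⟨hfull, ?_⟩
  rw [← hrange, hinf]
  constructor
  -- Cheap talk is worth exactly the lowest vertex value, so the chain itself separates that value
  -- from the maximum.
  · rintro ⟨h1, h2, h3, -⟩
    rw [hCT] at h3
    exact h3.trans (h2.trans h1)
  · intro hlt
    obtain ⟨μ₀, hμ₀⟩ := CheapTalk.exists_forall_le hc p
    have hmax : sSup (Set.range fun μ : CheapTalk.Belief Ω => v (T μ.1)) = v (T μ₀.1) := by
      refine IsGreatest.csSup_eq ⟨⟨μ₀, rfl⟩, ?_⟩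
      rintro _ ⟨μ, rfl⟩
      exact hμ₀ μ
    rw [hmax] at hlt ⊢
    have hMD := CheapTalk.lt_valueMD_of_moment hV hT hk hv_cont hv_qcvx hp hps hmin ⟨μ₀, hlt⟩
    refine ⟨CheapTalk.valueBP_lt hV hc hμ₀ (hp ω₀)
      (CheapTalk.moment_lt_of_pos hv_qcvx hμ₀ hlt),
      CheapTalk.valueMD_lt_valueBP hV hc (CheapTalk.edgeCoeff_nonneg hl) hp1 hout hMD, ?_, ?_⟩
    · rw [hCT]
      exact hMD
    · rw [hCT]
      exact hps
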